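/- Let $S$ be a set, let $\mathbf T$ be an equationally defined $S$-sorted algebraic theory (a set of operation symbols, each with a finite word of input sorts and an output sort, and a set of equations between terms in finite sorted contexts), and let $\mathcal A$ be a complete abelian category (all limits of the size of $S$ and $\mathbf T$ exist). Let $\mathcal M=\mathrm{Alg}(\mathbf T,\mathcal A)$ be the category of models of $\mathbf T$ in $\mathcal A$, let $\Box:\mathcal M\to\mathcal A^S$ be the forgetful functor, and let $F,G$ be models. An exact sequence $0\to G\to E_{n-1}\to\cdots\to E_0\to F\to 0$ in $\mathcal M$ ($n\ge 1$) is called $\Box$-split if each of the short exact sequences of which it is composed becomes split under $\Box$. An object $I$ of $\mathcal M$ is called $\Box$-injective if every morphism into $I$ extends along each monomorphism $f$ for which $\Box f$ is a split monomorphism. A $\Box$-injective coresolution of $G$ is an exact sequence $0\to G\xrightarrow{\varepsilon}\beta^0\to\beta^1\to\cdots$ with all $\beta^n$ $\Box$-injective whose image under $\Box$ is contractible. The relative Ext groups are $\mathrm{Ext}^0_\Box(F,G)=\mathrm{Hom}_{\mathcal M}(F,G)$ and, for $n\ge1$, $\mathrm{Ext}^n_\Box(F,G)$, the set of congruence classes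 of $n$-fold $\Box$-split exact sequences as above, with the Baer sum as addition; congruence is the equivalence relation generated by morphisms of sequences that are the identity on $G$ and on $F$. Then: 1. $\Box$ has a right adjoint, and for every right adjoint $R$ of $\Box$ the model $G$ has a $\Box$-injective coresolution whose terms are isomorphic to values of $R$. 2. For every $\Box$-injective coresolution $\beta$ of $G$ and every $n\ge 0$ there is an isomorphism of abelian groups $$\mathrm{Ext}^n_\Box(F,G)\;\cong\; H^n(\mathrm{Hom}_{\mathcal M}(F,\beta)).$$ For $n=0$ it sends $f$ to the class of $\varepsilon\circ f$. For $n\ge1$ it sends the congruence class of a sequence $0\to G\to E_{n-1}\to\cdots\to E_0\to F\to0$ to the class of the cocycle $c:F\to\beta^n$ that is the last component of any morphism from this sequence to $0\to G\to\beta^0\to\cdots\to\beta^{n}$ which is the identity on $G$ (such morphisms exist). 3. Two $\Box$-split short exact sequences $0\to G\to E\to F\to 0$ and $0\to G\to E'\to F\to 0$ define the same element of $\mathrm{Ext}^1_\Box(F,G)$ if and only if there is an isomorphism $E\cong E'$ compatible with the morphisms from $G$ and to $F$. Thus $H^1(\mathrm{Hom}_{\mathcal M}(F,\beta))$ classifies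 the $\Box$-split extensions of $G$ by $F$ up to isomorphism. -/

import Mathlib

open CategoryTheory CategoryTheory.Limits

universe w v u v' u' v'' u''

/-! ## Equationally defined algebraic theories with a set of sorts, and their models -/

/-- An `S`-sorted signature: every operation symbol has a word of input sorts and an output sort. -/
structure SortedSignature (S : Type w) where
  Op : Type w
  arity : Op → List S
  target : Op → S

namespace SortedSignature

variable {S : Type w} (sig : SortedSignature S)

/-- Terms of the signature in the context `Γ` (a word of sorts; its positions are the variables),
indexed by their sort. -/
inductive Term (Γ : List S) : S → Type w
  | var (i : Fin Γ.length) : Term Γ (Γ.get i)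
  | app (o : sig.Op) (args : ∀ i : Fin (sig.arity o).length, Term Γ ((sig.arity o).get i)) :
      Term Γ (sig.target o)

/-- A formal equation between two terms of the same sort in the same context. -/
structure Equation where
  ctx : List S
  sort : S
  lhs : sig.Term ctx sort
  rhs : sig.Term ctx sort

variable {sig} {C : Type u} [Category.{v} C] [HasFiniteProducts C]

/-- The interpretation of a term as a morphism out of the product of the objects attached to the
sorts of its context. -/
noncomputable def Term.eval {X : S → C}
    (op : ∀ o : sig.Op, (∏ᶜ fun i : Fin (sig.arity o).length => X ((sig.arity o).get i)) ⟶
      X (sig.target o)) {Γ : List S} :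
    ∀ {s : S}, sig.Term Γ s → ((∏ᶜ fun i : Fin Γ.length => X (Γ.get i)) ⟶ X s)
  | _, .var i => Pi.π (fun i : Fin Γ.length => X (Γ.get i)) i
  | _, .app o args => Pi.lift (fun i => Term.eval op (args i)) ≫ op o

end SortedSignature

/-- An equationally defined `S`-sorted algebraic theory: a signature and a set of equations. -/
structure AlgTheory (S : Type w) where
  sig : SortedSignature S
  eqns : Set sig.Equation

namespace AlgTheory

variable {S : Type w} (T : AlgTheory S)

/-- Models of the theory `T` in a category with finite products. -/
structure Alg (C : Type u) [Category.{v} C] [HasFiniteProducts C] where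
  carrier : S → C
  op : ∀ o : T.sig.Op,
    (∏ᶜ fun i : Fin (T.sig.arity o).length => carrier ((T.sig.arity o).get i)) ⟶
      carrier (T.sig.target o)
  sat : ∀ e ∈ T.eqns, e.lhs.eval op = e.rhs.eval op

namespace Alg

variable {T} {C : Type u} [Category.{v} C] [HasFiniteProducts C]

/-- Homomorphisms of models: families of morphisms that commute with the operations. -/
@[ext]
structure Hom (X Y : T.Alg C) where
  app : ∀ s, X.carrier s ⟶ Y.carrier s
  comm : ∀ o : T.sig.Op,
    X.op o ≫ app (T.sig.target o) =
      Limits.Pi.map (fun i : Fin (T.sig.arity o).length => app ((T.sig.arity o).get i)) ≫ Y.op o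

instance : Category (T.Alg C) where
  Hom := Hom
  id X :=
    { app := fun s => 𝟙 (X.carrier s)
      comm := fun o => by
        have h : Limits.Pi.map (fun i : Fin (T.sig.arity o).length =>
            𝟙 (X.carrier ((T.sig.arity o).get i))) = 𝟙 _ := by
          apply Pi.hom_ext; intro i; simp
        rw [h, Category.comp_id, Category.id_comp] }
  comp {X Y Z} f g :=
    { app := fun s => f.app s ≫ g.app s
      comm := fun o => by
        have h : Limits.Pi.map (fun i : Fin (T.sig.arity o).length =>
            f.app ((T.sig.arity o).get i) ≫ g.app ((T.sig.arity o).get i)) =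
            Limits.Pi.map (fun i => f.app ((T.sig.arity o).get i)) ≫
              Limits.Pi.map (fun i => g.app ((T.sig.arity o).get i)) := by
          apply Pi.hom_ext; intro i; simp
        rw [h, Category.assoc, ← g.comm, ← Category.assoc, f.comm, Category.assoc] }
  id_comp f := by apply Hom.ext; funext s; simp
  comp_id f := by apply Hom.ext; funext s; simp
  assoc f g h := by apply Hom.ext; funext s; simp

@[simp] lemma id_app (X : T.Alg C) (s : S) : Hom.app (𝟙 X) s = 𝟙 (X.carrier s) := rfl

@[simp] lemma comp_app {X Y Z : T.Alg C} (f : X ⟶ Y) (g : Y ⟶ Z) (s : S) :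
    Hom.app (f ≫ g) s = Hom.app f s ≫ Hom.app g s := rfl

lemma hom_ext {X Y : T.Alg C} {f g : X ⟶ Y} (h : ∀ s, Hom.app f s = Hom.app g s) : f = g :=
  Hom.ext (funext h)

section Preadditive

variable {A : Type u} [Category.{v} A] [Preadditive A] [HasFiniteProducts A]

instance (X Y : T.Alg A) : Zero (X ⟶ Y) :=
  ⟨{ app := fun _ => 0
     comm := fun o => by
      have h : Limits.Pi.map (fun i : Fin (T.sig.arity o).length =>
          (0 : X.carrier ((T.sig.arity o).get i) ⟶ Y.carrier ((T.sig.arity o).get i))) = 0 := by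
        apply Pi.hom_ext; intro i; simp
      rw [h, comp_zero, zero_comp] }⟩

instance (X Y : T.Alg A) : Add (X ⟶ Y) :=
  ⟨fun f g =>
    { app := fun s => Hom.app f s + Hom.app g s
      comm := fun o => by
        have h : Limits.Pi.map (fun i : Fin (T.sig.arity o).length =>
            Hom.app f ((T.sig.arity o).get i) + Hom.app g ((T.sig.arity o).get i)) =
            Limits.Pi.map (fun i => Hom.app f ((T.sig.arity o).get i)) +
              Limits.Pi.map (fun i => Hom.app g ((T.sig.arity o).get i)) := by
          apply Pi.hom_ext; intro i; simp
        rw [h, Preadditive.comp_add, Preadditive.add_comp, Hom.comm f, Hom.comm g] }⟩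

instance (X Y : T.Alg A) : Neg (X ⟶ Y) :=
  ⟨fun f =>
    { app := fun s => -Hom.app f s
      comm := fun o => by
        have h : Limits.Pi.map (fun i : Fin (T.sig.arity o).length =>
            -Hom.app f ((T.sig.arity o).get i)) =
            -Limits.Pi.map (fun i => Hom.app f ((T.sig.arity o).get i)) := by
          apply Pi.hom_ext; intro i; simp
        rw [h, Preadditive.comp_neg, Preadditive.neg_comp, Hom.comm f] }⟩

@[simp] lemma zero_app (X Y : T.Alg A) (s : S) : Hom.app (0 : X ⟶ Y) s = 0 := rfl

@[simp] lemma add_app {X Y : T.Alg A} (f g : X ⟶ Y) (s : S) :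
    Hom.app (f + g) s = Hom.app f s + Hom.app g s := rfl

@[simp] lemma neg_app {X Y : T.Alg A} (f : X ⟶ Y) (s : S) :
    Hom.app (-f) s = -Hom.app f s := rfl

instance (X Y : T.Alg A) : AddCommGroup (X ⟶ Y) where
  add_assoc f g h := hom_ext fun s => add_assoc _ _ _
  zero_add f := hom_ext fun s => zero_add _
  add_zero f := hom_ext fun s => add_zero _
  add_comm f g := hom_ext fun s => add_comm _ _
  neg_add_cancel f := hom_ext fun s => neg_add_cancel _
  nsmul := nsmulRec
  zsmul := zsmulRec

/-- Morphisms of models in a preadditive category are added componentwise. -/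
instance : Preadditive (T.Alg A) where
  add_comp _ _ _ f g h := hom_ext fun s => Preadditive.add_comp _ _ _ _ _ _
  comp_add _ _ _ f g h := hom_ext fun s => Preadditive.comp_add _ _ _ _ _ _

end Preadditive

end Alg

/-- The category `A^S` of families of objects is preadditive, componentwise. -/
instance piPreadditive {A : Type u} [Category.{v} A] [Preadditive A] :
    Preadditive (S → A) where
  homGroup X Y := inferInstanceAs (AddCommGroup (∀ s, X s ⟶ Y s))
  add_comp _ _ _ _ _ _ := funext fun _ => Preadditive.add_comp _ _ _ _ _ _
  comp_add _ _ _ _ _ _ := funext fun _ => Preadditive.comp_add _ _ _ _ _ _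

/-- The forgetful functor `□` from models of `T` to families of objects. -/
def forget (C : Type u) [Category.{v} C] [HasFiniteProducts C] : T.Alg C ⥤ (S → C) where
  obj X := X.carrier
  map f := Alg.Hom.app f

instance {A : Type u} [Category.{v} A] [Preadditive A] [HasFiniteProducts A] :
    (T.forget A).Additive where

end AlgTheory

/-! ## Homological algebra relative to an additive functor `U : M ⥤ B` -/

namespace RelHom

variable {M : Type u'} [Category.{v'} M] [Preadditive M]
  {B : Type u''} [Category.{v''} B] [Preadditive B] (U : M ⥤ B) [U.Additive]

/-- A `U`-split short extension `0 ⟶ G ⟶ E ⟶ F ⟶ 0` of `G` by `F`: a short exact sequence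
in `M` which becomes a split sequence after applying `U`. -/
structure ShortExt (F G : M) where
  E : M
  i : G ⟶ E
  p : E ⟶ F
  zero : i ≫ p = 0
  exact : (ShortComplex.mk i p zero).ShortExact
  split : Nonempty ((ShortComplex.mk i p zero).map U).Splitting

variable {U} in
/-- There is a morphism of short extensions with ends `α` and `γ`. -/
def ShortExt.HasHom {F G F' G' : M} (X : ShortExt U F G) (Y : ShortExt U F' G')
    (α : G ⟶ G') (γ : F ⟶ F') : Prop :=
  ∃ e : X.E ⟶ Y.E, X.i ≫ e = α ≫ Y.i ∧ X.p ≫ γ = e ≫ Y.p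

variable {U} in
/-- Equivalence of short extensions: an isomorphism of the middle terms, compatible with the
identities of the two ends. -/
def ShortExt.Equivalent {F G : M} (X Y : ShortExt U F G) : Prop :=
  ∃ e : X.E ≅ Y.E, X.i ≫ e.hom = Y.i ∧ e.hom ≫ Y.p = X.p

/-- `(k + 1)`-fold `U`-split exact sequences `0 ⟶ G ⟶ E_k ⟶ ⋯ ⟶ E_0 ⟶ F ⟶ 0`, presented as
composites of `k + 1` short ones: `0 ⟶ G ⟶ E_k ⟶ K ⟶ 0` followed by a `k`-fold sequence
from `K` to `F`. -/
def MultiExt : ℕ → M → M → Type (max u' v')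
  | 0, F, G => ShortExt U F G
  | k + 1, F, G => Σ K : M, ShortExt U K G × MultiExt k F K

variable {U}

/-- There is a morphism of exact sequences with ends `α` and `γ`. -/
def MultiExt.HasHom : ∀ (k : ℕ) {F G F' G' : M}, MultiExt U k F G → MultiExt U k F' G' →
    (G ⟶ G') → (F ⟶ F') → Prop
  | 0, _, _, _, _, X, Y, α, γ => ShortExt.HasHom X Y α γ
  | k + 1, _, _, _, _, X, Y, α, γ =>
      ∃ κ : X.1 ⟶ Y.1, X.2.1.HasHom Y.2.1 α κ ∧ MultiExt.HasHom k X.2.2 Y.2.2 κ γ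

/-- `Z` is a Baer sum `∇ (X ⊕ Y) Δ`: there are a direct sum `F ⊕ F`, an exact sequence `W` from
`G` to `F ⊕ F` with a morphism `X ⊕ Y ⟶ W` whose ends are the codiagonal of `G` and the identity
of `F ⊕ F` (that is, morphisms `X ⟶ W` and `Y ⟶ W` whose ends are the identity of `G` and the two
injections), and a morphism `Z ⟶ W` whose ends are the identity of `G` and the diagonal of `F`. -/
def MultiExt.IsBaerSum {k : ℕ} {F G : M} (X Y Z : MultiExt U k F G) : Prop :=
  ∃ (b : BinaryBicone F F) (_ : Nonempty b.IsBilimit) (W : MultiExt U k b.pt G),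
    MultiExt.HasHom k X W (𝟙 G) b.inl ∧ MultiExt.HasHom k Y W (𝟙 G) b.inr ∧
      MultiExt.HasHom k Z W (𝟙 G) (b.inl + b.inr)

variable (U)

/-- The relative extension group `Ext_U^(k+1)(F, G)` as a set: congruence classes of
`(k + 1)`-fold `U`-split exact sequences, congruence being the equivalence relation generated by
the existence of a morphism which is the identity on both ends. -/
def RelExt (k : ℕ) (F G : M) : Type (max u' v') :=
  Quot fun X Y : MultiExt U k F G => MultiExt.HasHom k X Y (𝟙 G) (𝟙 F)

variable {U}

/-- The congruence class of an exact sequence. -/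
def RelExt.mk {k : ℕ} {F G : M} (X : MultiExt U k F G) : RelExt U k F G := Quot.mk _ X

/-- The addition of `Ext_U^(k+1)(F, G)`, as a relation: `z` is the Baer sum of `x` and `y`. -/
def RelExt.IsSum {k : ℕ} {F G : M} (x y z : RelExt U k F G) : Prop :=
  ∃ X Y Z : MultiExt U k F G,
    RelExt.mk X = x ∧ RelExt.mk Y = y ∧ RelExt.mk Z = z ∧ MultiExt.IsBaerSum X Y Z

variable (U)

/-- `I` is `U`-injective: morphisms to `I` extend along every monomorphism which `U` takes to a
split monomorphism. -/
def IsRelInjective (I : M) : Prop :=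
  ∀ ⦃X Y : M⦄ (f : X ⟶ Y), Mono f → IsSplitMono (U.map f) → ∀ g : X ⟶ I, ∃ h : Y ⟶ I, f ≫ h = g

/-- A `U`-injective coresolution `0 ⟶ G ⟶ β⁰ ⟶ β¹ ⟶ ⋯`: the terms `βⁿ` are `U`-injective, the
augmented complex is exact, and it is `U`-split, i.e. its image under `U` has a contracting
homotopy (`s`, `t`). -/
structure InjCoresolution (G : M) where
  cx : CochainComplex M ℕ
  ε : G ⟶ cx.X 0
  ε_d : ε ≫ cx.d 0 1 = 0
  injective : ∀ n, IsRelInjective U (cx.X n)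
  mono : Mono ε
  exact_zero : (ShortComplex.mk ε (cx.d 0 1) ε_d).Exact
  exact_succ : ∀ n, (ShortComplex.mk (cx.d n (n + 1)) (cx.d (n + 1) (n + 2))
    (cx.d_comp_d n (n + 1) (n + 2))).Exact
  split : ∃ (s : U.obj (cx.X 0) ⟶ U.obj G)
    (t : ∀ n, U.obj (cx.X (n + 1)) ⟶ U.obj (cx.X n)),
    U.map ε ≫ s = 𝟙 (U.obj G) ∧
    s ≫ U.map ε + U.map (cx.d 0 1) ≫ t 0 = 𝟙 (U.obj (cx.X 0)) ∧
    ∀ n, t n ≫ U.map (cx.d n (n + 1)) + U.map (cx.d (n + 1) (n + 2)) ≫ t (n + 1) =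
      𝟙 (U.obj (cx.X (n + 1)))

/-- The cochain complex of abelian groups `Hom_M(F, K)`. -/
noncomputable def homComplex (F : M) (K : CochainComplex M ℕ) :
    CochainComplex AddCommGrpCat.{v'} ℕ :=
  ((preadditiveCoyoneda.obj (Opposite.op F)).mapHomologicalComplex _).obj K

/-- The cohomology group `Hⁿ(Hom_M(F, K))`. -/
noncomputable abbrev homCohomology (F : M) (K : CochainComplex M ℕ) (n : ℕ) : Type v' :=
  (homComplex F K).homology n

/-- `c : F ⟶ Kⁿ` is a cocycle of `Hom_M(F, K)` with cohomology class `h`. -/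
def HasClass {F : M} {K : CochainComplex M ℕ} {n : ℕ} (c : F ⟶ K.X n)
    (h : homCohomology F K n) : Prop :=
  ∃ z : (homComplex F K).cycles n,
    ((homComplex F K).iCycles n z : F ⟶ K.X n) = c ∧ (homComplex F K).homologyπ n z = h

variable {U}

/-- For an exact sequence `X = (0 ⟶ G ⟶ E_k ⟶ ⋯ ⟶ E_0 ⟶ F ⟶ 0)` and `a : G ⟶ K^m`,
`IsComparison K k X m a j c` says that there is a commutative ladder from `X` to
`K^m ⟶ K^(m+1) ⟶ ⋯ ⟶ K^j` (with `E_k` over `K^m`, `j = m + k + 1`), i.e. morphisms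
`f : E_k ⟶ K^m`, … extending `a`, whose last component is `c : F ⟶ K^j`. -/
def IsComparison (K : CochainComplex M ℕ) : ∀ (k : ℕ) {F G : M}, MultiExt U k F G →
    ∀ (m : ℕ), (G ⟶ K.X m) → ∀ (j : ℕ), (F ⟶ K.X j) → Prop
  | 0, _, _, X, m, a, j, c =>
      ∃ f : X.E ⟶ K.X m, X.i ≫ f = a ∧ X.p ≫ c = f ≫ K.d m j
  | k + 1, _, _, X, m, a, j, c =>
      ∃ (f : X.2.1.E ⟶ K.X m) (g : X.1 ⟶ K.X (m + 1)),
        X.2.1.i ≫ f = a ∧ X.2.1.p ≫ g = f ≫ K.d m (m + 1) ∧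
          IsComparison K k X.2.2 (m + 1) g j c

end RelHom

/-! This is homological algebra relative to an additive, faithful, left exact functor `U : M ⥤ B`
between an abelian and a preadditive category, together with the verification that `□` is such a
functor and has a right adjoint. Relative injectivity extends the identity of `G` to a ladder from a
`U`-split sequence to the coresolution `β`. The ends of two such ladders differ by a coboundary
(`IsComparison.exists_eq_comp_d`), so the sequence has a well-defined class, and congruent sequences
have the same class. Conversely, a cocycle `c : F ⟶ βᵏ⁺¹` is realized by truncating `β` and pulling
back its last differential along `c`; the contracting homotopy splits the result under `U`. This
sequence is final among those with a ladder ending in `c` (`exists_multiExt_of_cocycle`). Hence two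
sequences with the same class both map to a common one, which gives injectivity; finality for a
cocycle on `F ⊕ F` yields the Baer sums. If `U ⊣ R`, the values of `R` are relatively injective and
the counit splits the unit `G ⟶ R U G` under `U`; iterating on cokernels gives a coresolution
(`exists_injCoresolution`). For the right adjoint of `□`, finite products in `A` are also
coproducts, so an operation amounts to one unary map per input. Without equations a model is then a
representation of a quiver on `S`, whose cofree objects are products over paths; the equations cut
out a kernel (`cofree`). Completeness of `A` enters only here. The same additivity makes cokernels
of models sortwise, so that models form an abelian category. -/

namespace RelHom

/-! ### Cohomology classes of cocycles -/

section Classes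

variable {M : Type u'} [Category.{v'} M] [Preadditive M] {F : M} {K : CochainComplex M ℕ} {n : ℕ}

lemma iCycles_injective : Function.Injective ((homComplex F K).iCycles n) :=
  (AddCommGrpCat.mono_iff_injective _).1 inferInstance

lemma HasClass.comp_d {c : F ⟶ K.X n} {h : homCohomology F K n} (hc : HasClass c h) (m : ℕ) :
    c ≫ K.d n m = 0 := by
  obtain ⟨z, rfl, -⟩ := hc
  have := (homComplex F K).iCycles_d n m
  exact congrArg (fun f => f.hom z) this

lemma exists_hasClass_of_comp_d (c : F ⟶ K.X n) (hc : c ≫ K.d n (n + 1) = 0) :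
    ∃ h : homCohomology F K n, HasClass c h := by
  have hex := ShortComplex.exact_of_f_is_kernel
    (ShortComplex.mk ((homComplex F K).iCycles n) ((homComplex F K).d n (n + 1)) (by simp))
    ((homComplex F K).cyclesIsKernel n (n + 1) (by simp))
  obtain ⟨z, hz⟩ := (ShortComplex.ab_exact_iff _).1 hex c hc
  exact ⟨_, z, hz, rfl⟩

lemma exists_hasClass (h : homCohomology F K n) : ∃ c : F ⟶ K.X n, HasClass c h := by
  obtain ⟨z, rfl⟩ := (AddCommGrpCat.epi_iff_surjective ((homComplex F K).homologyπ n)).1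
    inferInstance h
  exact ⟨_, z, rfl, rfl⟩

lemma HasClass.add {c c' : F ⟶ K.X n} {h h' : homCohomology F K n} (hc : HasClass c h)
    (hc' : HasClass c' h') : HasClass (c + c') (h + h') := by
  obtain ⟨z, rfl, rfl⟩ := hc
  obtain ⟨z', rfl, rfl⟩ := hc'
  exact ⟨z + z', map_add _ _ _, map_add _ _ _⟩

/-- Two cocycles have the same class if and only if they differ by a coboundary. -/
lemma HasClass.eq_iff {c c' : F ⟶ K.X n} {h h' : homCohomology F K n} (hc : HasClass c h)
    (hc' : HasClass c' h') :
    h = h' ↔ ∃ (l : ℕ) (b : F ⟶ K.X l), c = c' + b ≫ K.d l n := by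
  obtain ⟨z, rfl, rfl⟩ := hc
  obtain ⟨z', rfl, rfl⟩ := hc'
  constructor
  · intro h
    have hex := ShortComplex.exact_of_g_is_cokernel
      (ShortComplex.mk ((homComplex F K).toCycles ((ComplexShape.up ℕ).prev n) n)
        ((homComplex F K).homologyπ n) (by simp))
      ((homComplex F K).homologyIsCokernel _ n rfl)
    -- For `n = 0` the predecessor is `0` itself and the differential `d 0 0` vanishes. Leaving `l`
    -- free in the statement thus covers degree `0` without a separate case.
    obtain ⟨b, hb⟩ := (ShortComplex.ab_exact_iff _).1 hex (z - z')
      ((map_sub _ z z').trans (sub_eq_zero.2 h))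
    refine ⟨_, b, ?_⟩
    have hd : (homComplex F K).iCycles n (z - z') = _ :=
      (congrArg ((homComplex F K).iCycles n) hb).symm.trans
        (congrArg (fun f => f.hom b) ((homComplex F K).toCycles_i _ n))
    exact (sub_eq_iff_eq_add'.1 ((map_sub _ z z').symm.trans hd))
  · rintro ⟨l, b, hb⟩
    have hz : z = z' + (homComplex F K).toCycles l n b := by
      apply iCycles_injective
      refine hb.trans ?_
      refine ((map_add _ _ _).trans ?_).symm
      exact congrArg _ (congrArg (fun f => f.hom b) ((homComplex F K).toCycles_i l n))
    rw [hz]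
    refine (map_add _ _ _).trans ?_
    have : (homComplex F K).homologyπ n ((homComplex F K).toCycles l n b) = 0 :=
      congrArg (fun f => f.hom b) ((homComplex F K).toCycles_comp_homologyπ l n)
    rw [this, add_zero]

lemma HasClass.unique {c : F ⟶ K.X n} {h h' : homCohomology F K n} (hc : HasClass c h)
    (hc' : HasClass c h') : h = h' :=
  (hc.eq_iff hc').2 ⟨n, 0, by simp⟩

end Classes

/-! ### Comparison of split exact sequences with an injective coresolution -/

section Comparison

variable {M : Type u'} [Category.{v'} M] [Abelian M]
  {B : Type u''} [Category.{v''} B] [Preadditive B] {U : M ⥤ B} [U.Additive]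

lemma ShortExt.mono_i {F G : M} (X : ShortExt U F G) : Mono X.i := X.exact.mono_f

lemma ShortExt.epi_p {F G : M} (X : ShortExt U F G) : Epi X.p := X.exact.epi_g

lemma ShortExt.isSplitMono_map_i {F G : M} (X : ShortExt U F G) : IsSplitMono (U.map X.i) :=
  X.split.some.isSplitMono_f

/-- A morphism that vanishes on the subobject of a short extension factors through the quotient. -/
lemma ShortExt.exists_desc {F G : M} (X : ShortExt U F G) {Y : M} (f : X.E ⟶ Y)
    (hf : X.i ≫ f = 0) : ∃ g : F ⟶ Y, X.p ≫ g = f :=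
  have := X.epi_p
  ⟨X.exact.exact.desc f hf, X.exact.exact.g_desc f hf⟩

/-- Ladders compose with morphisms of sequences. This gives invariance of the class under congruence
as well as its behaviour along the three morphisms of a Baer sum. -/
lemma MultiExt.HasHom.isComparison {K : CochainComplex M ℕ} :
    ∀ {k : ℕ} {F G F' G' : M} {X : MultiExt U k F G} {Y : MultiExt U k F' G'} {α : G ⟶ G'}
      {γ : F ⟶ F'} {m : ℕ} {a : G' ⟶ K.X m} {j : ℕ} {c : F' ⟶ K.X j},
      MultiExt.HasHom k X Y α γ → IsComparison K k Y m a j c →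
        IsComparison K k X m (α ≫ a) j (γ ≫ c)
  | 0, _, _, _, _, X, Y, α, γ, m, a, j, c, ⟨e, he, he'⟩, ⟨f, hf, hf'⟩ =>
      ⟨e ≫ f, by rw [← Category.assoc, he, Category.assoc, hf],
        by rw [← Category.assoc, he', Category.assoc, hf', Category.assoc]⟩
  | k + 1, _, _, _, _, X, Y, α, γ, m, a, j, c, ⟨κ, ⟨e, he, he'⟩, h⟩, ⟨f, g, hf, hf', h'⟩ =>
      ⟨e ≫ f, κ ≫ g, by rw [← Category.assoc, he, Category.assoc, hf],
        by rw [← Category.assoc, he', Category.assoc, hf', Category.assoc], h.isComparison h'⟩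

/-- Comparisons exist, and their last component is a cocycle. -/
lemma exists_isComparison {K : CochainComplex M ℕ} (hK : ∀ n, IsRelInjective U (K.X n)) :
    ∀ (k : ℕ) {F G : M} (X : MultiExt U k F G) (m : ℕ) (a : G ⟶ K.X m) (j : ℕ),
      a ≫ K.d m (m + 1) = 0 → j = m + k + 1 → ∃ c : F ⟶ K.X j, IsComparison K k X m a j c
  | 0, F, G, X, m, a, j, ha, hj => by
      obtain ⟨f, hf⟩ := hK m X.i X.mono_i X.isSplitMono_map_i a
      obtain rfl : j = m + 1 := hj
      obtain ⟨c, hc⟩ := ShortExt.exists_desc X (f ≫ K.d m (m + 1))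
        (by rw [← Category.assoc, hf, ha])
      exact ⟨c, f, hf, hc⟩
  | k + 1, F, G, X, m, a, j, ha, hj => by
      obtain ⟨f, hf⟩ := hK m X.2.1.i X.2.1.mono_i X.2.1.isSplitMono_map_i a
      obtain ⟨g, hg⟩ := X.2.1.exists_desc (f ≫ K.d m (m + 1))
        (by rw [← Category.assoc, hf, ha])
      -- The recursion continues with `g` in place of `a`, so `g` must again be killed by the
      -- differential. This can be tested after the epimorphism `p`, where it becomes `d ≫ d = 0`.
      have hg0 : g ≫ K.d (m + 1) (m + 1 + 1) = 0 := by
        have := X.2.1.epi_p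
        rw [← cancel_epi X.2.1.p, ← Category.assoc, hg]
        simp
      obtain ⟨c, hc⟩ := exists_isComparison hK k X.2.2 (m + 1) g j hg0 (by omega)
      exact ⟨c, f, g, hf, hg, hc⟩

lemma IsComparison.comp_d {K : CochainComplex M ℕ} :
    ∀ {k : ℕ} {F G : M} {X : MultiExt U k F G} {m : ℕ} {a : G ⟶ K.X m} {j : ℕ} {c : F ⟶ K.X j},
      IsComparison K k X m a j c → c ≫ K.d j (j + 1) = 0
  | 0, _, _, X, m, a, j, c, ⟨f, hf, hf'⟩ => by
      have := ShortExt.epi_p X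
      rw [← cancel_epi X.p, ← Category.assoc, hf']
      simp
  | k + 1, _, _, X, m, a, j, c, ⟨f, g, hf, hg, h⟩ => h.comp_d

lemma IsComparison.sub {K : CochainComplex M ℕ} :
    ∀ {k : ℕ} {F G : M} {X : MultiExt U k F G} {m : ℕ} {a a' : G ⟶ K.X m} {j : ℕ}
      {c c' : F ⟶ K.X j}, IsComparison K k X m a j c → IsComparison K k X m a' j c' →
        IsComparison K k X m (a - a') j (c - c')
  | 0, _, _, X, m, a, _, j, c, _, ⟨f, hf, hf'⟩, ⟨g, hg, hg'⟩ =>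
      ⟨f - g, by rw [Preadditive.comp_sub, hf, hg],
        by rw [Preadditive.comp_sub, Preadditive.sub_comp, hf', hg']⟩
  | k + 1, _, _, X, m, a, _, j, c, _, ⟨f, g, hf, hg, h⟩, ⟨f', g', hf', hg', h'⟩ =>
      ⟨f - f', g - g', by rw [Preadditive.comp_sub, hf, hf'],
        by rw [Preadditive.comp_sub, Preadditive.sub_comp, hg, hg'], h.sub h'⟩

/-- A comparison whose first component is a coboundary ends in a coboundary. -/
lemma IsComparison.exists_eq_comp_d {K : CochainComplex M ℕ}
    (hK : ∀ n, IsRelInjective U (K.X n)) :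
    ∀ {k : ℕ} {F G : M} {X : MultiExt U k F G} {m : ℕ} {a : G ⟶ K.X m} {j : ℕ} {c : F ⟶ K.X j},
      IsComparison K k X m a j c → (∃ (l : ℕ) (b : G ⟶ K.X l), a = b ≫ K.d l m) →
        ∃ (l : ℕ) (b : F ⟶ K.X l), c = b ≫ K.d l j
  | 0, _, _, X, m, a, j, c, ⟨f, hf, hf'⟩, ⟨l, b, hb⟩ => by
      -- Extend `b` to `b₁` on the middle term. Then `f - b₁ ≫ d` vanishes on the subobject and
      -- descends to `b₂`, and `b₁` disappears from `b₂ ≫ d` because `d ≫ d = 0`.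
      obtain ⟨b₁, hb₁⟩ := hK l X.i X.mono_i X.isSplitMono_map_i b
      obtain ⟨b₂, hb₂⟩ := ShortExt.exists_desc X (f - b₁ ≫ K.d l m)
        (by rw [Preadditive.comp_sub, hf, ← Category.assoc, hb₁, hb, sub_self])
      refine ⟨m, b₂, ?_⟩
      have := ShortExt.epi_p X
      rw [← cancel_epi X.p, ← Category.assoc, hb₂, hf', Preadditive.sub_comp]
      simp
  | k + 1, _, _, X, m, a, j, c, ⟨f, g, hf, hf', h⟩, ⟨l, b, hb⟩ => by
      obtain ⟨b₁, hb₁⟩ := hK l X.2.1.i X.2.1.mono_i X.2.1.isSplitMono_map_i b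
      obtain ⟨b₂, hb₂⟩ := X.2.1.exists_desc (f - b₁ ≫ K.d l m)
        (by rw [Preadditive.comp_sub, hf, ← Category.assoc, hb₁, hb, sub_self])
      refine h.exists_eq_comp_d hK ⟨m, b₂, ?_⟩
      have := X.2.1.epi_p
      rw [← cancel_epi X.2.1.p, ← Category.assoc, hb₂, hf', Preadditive.sub_comp]
      simp

/-- The last component of a comparison can be changed by a coboundary. -/
lemma IsComparison.add_comp_d {K : CochainComplex M ℕ} :
    ∀ {k : ℕ} {F G : M} {X : MultiExt U k F G} {m : ℕ} {a : G ⟶ K.X m} {j : ℕ} {c : F ⟶ K.X j},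
      j = m + k + 1 → IsComparison K k X m a j c → ∀ (l : ℕ) (b : F ⟶ K.X l),
        IsComparison K k X m a j (c + b ≫ K.d l j)
  | 0, _, _, X, m, a, j, c, hj, ⟨f, hf, hf'⟩, l, b => by
      -- Only the last vertical map of the ladder changes, by `X.p ≫ b`. If `l ≠ m`, then `l + 1 ≠
      -- j` and the added coboundary is zero.
      by_cases hl : l = m
      · subst hl
        refine ⟨f + X.p ≫ b, ?_, ?_⟩
        · have h0 := X.zero
          rw [Preadditive.comp_add, hf, reassoc_of% h0, zero_comp, add_zero]
        · rw [Preadditive.comp_add, Preadditive.add_comp, hf', Category.assoc]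
      · rw [K.shape l j (by simp only [ComplexShape.up_Rel]; omega), comp_zero, add_zero]
        exact ⟨f, hf, hf'⟩
  | k + 1, _, _, X, m, a, j, c, hj, ⟨f, g, hf, hf', h⟩, l, b =>
      ⟨f, g, hf, hf', h.add_comp_d (by omega) l b⟩

/-! ### Realizing cocycles by split exact sequences. -/

variable [U.Faithful] [PreservesFiniteLimits U]

/-- A kernel sequence whose second morphism has a section after applying `U` is a `U`-split short
extension. -/
lemma exists_shortExt_of_section {F G E : M} (i : G ⟶ E) (p : E ⟶ F) (w : i ≫ p = 0) [Mono i]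
    (hex : (ShortComplex.mk i p w).Exact) (s : U.obj F ⟶ U.obj E) (hs : s ≫ U.map p = 𝟙 _) :
    (ShortComplex.mk i p w).ShortExact ∧ Nonempty ((ShortComplex.mk i p w).map U).Splitting := by
  have : Epi p := by
    have : IsSplitEpi (U.map p) := ⟨⟨⟨s, hs⟩⟩⟩
    exact U.epi_of_epi_map inferInstance
  refine ⟨{ exact := hex, mono_f := ‹_›, epi_g := this }, ⟨?_⟩⟩
  have hk := KernelFork.mapIsLimit _ hex.fIsKernel U
  have hm : Mono (U.map i) := inferInstance
  -- The retraction is the factorization of the idempotent `1 - U(p) s` through `U(i)`, which is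
  -- still a kernel of `U(p)` by left exactness.
  have hw : (𝟙 _ - U.map p ≫ s) ≫ U.map p = 0 := by simp [Preadditive.sub_comp, hs]
  let r : U.obj E ⟶ U.obj G := hk.lift (KernelFork.ofι _ hw)
  have hr : r ≫ U.map i = 𝟙 _ - U.map p ≫ s :=
    hk.fac (KernelFork.ofι _ hw) WalkingParallelPair.zero
  have hfr : U.map i ≫ r = 𝟙 _ := by
    have h0 : U.map i ≫ U.map p = 0 := by rw [← U.map_comp, w, U.map_zero]
    rw [← cancel_mono (U.map i), Category.assoc, hr, Preadditive.comp_sub, reassoc_of% h0]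
    simp
  exact
    { r := r
      s := s
      f_r := hfr
      s_g := hs
      id := by
        change r ≫ U.map i + U.map p ≫ s = 𝟙 _
        rw [hr, sub_add_cancel] }

variable {G₀ : M} (β : InjCoresolution U G₀)

/-- The pullback of `G ⟶ βᵐ ⟶ βᵐ⁺¹` along a cocycle is a split extension, and it is the final one
with a comparison to the cocycle. -/
lemma exists_shortExt_of_cocycle {F G : M} {m : ℕ} (a : G ⟶ β.cx.X m) [Mono a]
    (w : a ≫ β.cx.d m (m + 1) = 0) (hex : (ShortComplex.mk a (β.cx.d m (m + 1)) w).Exact)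
    (c : F ⟶ β.cx.X (m + 1)) (hc : c ≫ β.cx.d (m + 1) (m + 2) = 0) :
    ∃ P : ShortExt U F G,
      (∃ f : P.E ⟶ β.cx.X m, P.i ≫ f = a ∧ P.p ≫ c = f ≫ β.cx.d m (m + 1)) ∧
      ∀ {F' G' : M} (X : ShortExt U F' G') (a' : G' ⟶ G) (γ : F' ⟶ F) (f : X.E ⟶ β.cx.X m),
        X.i ≫ f = a' ≫ a → X.p ≫ γ ≫ c = f ≫ β.cx.d m (m + 1) → X.HasHom P a' γ := by
  obtain ⟨-, t, -, -, ht⟩ := β.split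
  let i : G ⟶ pullback c (β.cx.d m (m + 1)) := pullback.lift 0 a (by simp [w])
  have hi₁ : i ≫ pullback.fst _ _ = 0 := pullback.lift_fst _ _ _
  have hi₂ : i ≫ pullback.snd _ _ = a := pullback.lift_snd _ _ _
  have : Mono i := by
    have : Mono (i ≫ pullback.snd _ _) := by rwa [hi₂]
    exact mono_of_mono i (pullback.snd _ _)
  have hex' : (ShortComplex.mk i (pullback.fst c (β.cx.d m (m + 1))) hi₁).Exact := by
    refine ShortComplex.exact_of_f_is_kernel _ (KernelFork.IsLimit.ofι' _ _ fun {A} k hk => ?_)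
    have hk' : (k ≫ pullback.snd _ _) ≫ β.cx.d m (m + 1) = 0 := by
      rw [Category.assoc, ← pullback.condition, ← Category.assoc, hk, zero_comp]
    refine ⟨hex.lift (k ≫ pullback.snd _ _) hk', ?_⟩
    apply pullback.hom_ext
    · exact (Category.assoc _ _ _).trans ((congrArg _ hi₁).trans (comp_zero.trans hk.symm))
    · exact (Category.assoc _ _ _).trans ((congrArg _ hi₂).trans (hex.lift_f _ hk'))
  -- Since `c` is a cocycle, the homotopy identity in degree `m + 1` reduces on `U(c)` to `U(c) t d
  -- = U(c)`. So `1` and `U(c) t` define a section of the pullback projection under `U`;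
  -- faithfulness then makes the projection itself an epimorphism.
  have hs : 𝟙 _ ≫ U.map c = (U.map c ≫ t m) ≫ U.map (β.cx.d m (m + 1)) := by
    have h := congrArg (fun x => U.map c ≫ x) (ht m)
    have h0 : U.map c ≫ U.map (β.cx.d (m + 1) (m + 2)) = 0 := by
      rw [← U.map_comp, hc, U.map_zero]
    simp only [Preadditive.comp_add, reassoc_of% h0, zero_comp, add_zero, Category.comp_id] at h
    rw [Category.id_comp, Category.assoc, h]
  have hpb := (IsPullback.of_hasPullback c (β.cx.d m (m + 1))).map U
  obtain ⟨h₁, h₂⟩ := exists_shortExt_of_section (U := U) i (pullback.fst c (β.cx.d m (m + 1))) hi₁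
    hex' (hpb.lift _ _ hs) (hpb.lift_fst _ _ hs)
  refine ⟨⟨_, i, _, hi₁, h₁, h₂⟩, ⟨pullback.snd _ _, hi₂, pullback.condition⟩, ?_⟩
  intro F' G' X a' γ f hf hf'
  obtain ⟨e, he₁, he₂⟩ : ∃ e : X.E ⟶ pullback c (β.cx.d m (m + 1)),
      e ≫ pullback.fst _ _ = X.p ≫ γ ∧ e ≫ pullback.snd _ _ = f :=
    have h := (Category.assoc _ _ _).trans hf'
    ⟨pullback.lift (X.p ≫ γ) f h, pullback.lift_fst _ _ _, pullback.lift_snd _ _ _⟩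
  refine ⟨e, (?_ : X.i ≫ e = a' ≫ i), he₁.symm⟩
  apply pullback.hom_ext
  · have h0 := X.zero
    rw [Category.assoc, Category.assoc, hi₁, he₁, comp_zero, reassoc_of% h0, zero_comp]
  · rw [Category.assoc, Category.assoc, hi₂, he₂, hf]

/-- Every cocycle is the end of a comparison of some sequence, the final one with this property. -/
lemma exists_multiExt_of_cocycle : ∀ (k : ℕ) {F G : M} {m j : ℕ} (_ : j = m + k + 1)
    (a : G ⟶ β.cx.X m) [Mono a]
    (w : a ≫ β.cx.d m (m + 1) = 0) (_ : (ShortComplex.mk a (β.cx.d m (m + 1)) w).Exact)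
    (c : F ⟶ β.cx.X j) (_ : c ≫ β.cx.d j (j + 1) = 0),
    ∃ P : MultiExt U k F G, IsComparison β.cx k P m a j c ∧
      ∀ {F' G' : M} (X : MultiExt U k F' G') (a' : G' ⟶ G) (γ : F' ⟶ F),
        IsComparison β.cx k X m (a' ≫ a) j (γ ≫ c) → MultiExt.HasHom k X P a' γ
  | 0, F, G, m, j, hj, a, _, w, hex, c, hc => by
      obtain rfl : j = m + 1 := hj
      obtain ⟨P, hP, hP'⟩ := exists_shortExt_of_cocycle β a w hex c hc
      exact ⟨P, hP, fun X a' γ ⟨f, hf, hf'⟩ => hP' X a' γ f hf hf'⟩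
  | k + 1, F, G, m, j, hj, a, _, w, hex, c, hc => by
      -- Splice at the kernel of the next differential. The inclusion of that kernel plays the role
      -- of `a` in the recursion, and the map `g` of any competing ladder is a cocycle, hence
      -- factors through the kernel; this factorization is the required morphism at the splice.
      obtain ⟨P, ⟨f, hf, hf'⟩, hP'⟩ := exists_shortExt_of_cocycle β a w hex
        (kernel.ι (β.cx.d (m + 1) (m + 2))) (kernel.condition _)
      obtain ⟨Q, hQ, hQ'⟩ := exists_multiExt_of_cocycle k (F := F) (m := m + 1) (j := j)
        (by omega) (kernel.ι (β.cx.d (m + 1) (m + 2))) (kernel.condition _)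
        (ShortComplex.exact_of_f_is_kernel _ (kernelIsKernel _)) c hc
      refine ⟨⟨_, P, Q⟩, ⟨f, _, hf, hf', hQ⟩, ?_⟩
      rintro F' G' X a' γ ⟨f', g, h₁, h₂, h₃⟩
      have hg0 : g ≫ β.cx.d (m + 1) (m + 2) = 0 := by
        have := X.2.1.epi_p
        rw [← cancel_epi X.2.1.p, ← Category.assoc, h₂]
        simp
      refine ⟨kernel.lift _ g hg0, hP' _ _ _ f' h₁ ?_, hQ' _ _ _ ?_⟩
      · rw [kernel.lift_ι, h₂]
      · rwa [kernel.lift_ι]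

end Comparison

/-! ### The relative extension groups -/

section RelExt

variable {M : Type u'} [Category.{v'} M] [Abelian M]
  {B : Type u''} [Category.{v''} B] [Preadditive B] {U : M ⥤ B}
  {F G : M} (β : InjCoresolution U G)

/-- The morphisms from `F` to `G` are the `0`-th cohomology. -/
theorem exists_addEquiv_homCohomology_zero :
    ∃ Φ : (F ⟶ G) ≃+ homCohomology F β.cx 0, ∀ f : F ⟶ G, HasClass (f ≫ β.ε) (Φ f) := by
  have h (f : F ⟶ G) : ∃ h : homCohomology F β.cx 0, HasClass (f ≫ β.ε) h :=
    exists_hasClass_of_comp_d _ (by rw [Category.assoc, β.ε_d, comp_zero])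
  choose φ hφ using h
  have := β.mono
  -- There are no nonzero coboundaries in degree `0`, so a class is a single cocycle, that is, a
  -- morphism through the kernel `ε`.
  have hd (l : ℕ) : β.cx.d l 0 = 0 := β.cx.shape _ _ (by simp)
  refine ⟨AddEquiv.ofBijective (AddMonoidHom.mk' φ fun f g => ?_) ⟨fun f g hfg => ?_, fun h => ?_⟩,
    hφ⟩
  · refine (hφ (f + g)).unique ?_
    rw [Preadditive.add_comp]
    exact (hφ f).add (hφ g)
  · obtain ⟨l, b, hb⟩ := ((hφ f).eq_iff (hφ g)).1 hfg
    rwa [hd, comp_zero, add_zero, cancel_mono] at hb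
  · obtain ⟨c, hc⟩ := exists_hasClass h
    refine ⟨β.exact_zero.lift c (hc.comp_d 1), (hφ _).unique ?_⟩
    rwa [show β.exact_zero.lift c (hc.comp_d 1) ≫ β.ε = c from β.exact_zero.lift_f _ _]

variable [U.Additive]

lemma exists_isComparison_hasClass {k : ℕ} (X : MultiExt U k F G) :
    ∃ (h : homCohomology F β.cx (k + 1)) (c : F ⟶ β.cx.X (k + 1)),
      IsComparison β.cx k X 0 β.ε (k + 1) c ∧ HasClass c h := by
  obtain ⟨c, hc⟩ := exists_isComparison β.injective k X 0 β.ε (k + 1) β.ε_d (by omega)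
  obtain ⟨h, hh⟩ := exists_hasClass_of_comp_d c hc.comp_d
  exact ⟨h, c, hc, hh⟩

variable {β}

/-- The difference of the two ladders starts with `0`, which is a coboundary, and so ends in a
coboundary. -/
lemma IsComparison.class_unique {k : ℕ} {X : MultiExt U k F G}
    {h h' : homCohomology F β.cx (k + 1)} {c c' : F ⟶ β.cx.X (k + 1)}
    (hX : IsComparison β.cx k X 0 β.ε (k + 1) c) (hc : HasClass c h)
    (hX' : IsComparison β.cx k X 0 β.ε (k + 1) c') (hc' : HasClass c' h') : h = h' := by
  obtain ⟨l, b, hb⟩ := (hX.sub hX').exists_eq_comp_d β.injective ⟨0, 0, by simp⟩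
  exact (hc.eq_iff hc').2 ⟨l, b, by rw [← hb]; abel⟩

/-- Every representative of the class of a sequence is the end of a comparison. -/
lemma IsComparison.of_hasClass {k : ℕ} {X : MultiExt U k F G}
    {h : homCohomology F β.cx (k + 1)} {c c' : F ⟶ β.cx.X (k + 1)}
    (hX : IsComparison β.cx k X 0 β.ε (k + 1) c) (hc : HasClass c h) (hc' : HasClass c' h) :
    IsComparison β.cx k X 0 β.ε (k + 1) c' := by
  obtain ⟨l, b, rfl⟩ := (hc'.eq_iff hc).1 rfl
  exact hX.add_comp_d (by omega) l b

/-- Two short extensions have the same class if and only if they are equivalent. -/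
theorem mk_eq_mk_iff_equivalent (X Y : ShortExt U F G) :
    RelExt.mk (k := 0) X = RelExt.mk (k := 0) Y ↔ X.Equivalent Y := by
  constructor
  · intro h
    have h' := Quot.eqvGen_exact h
    clear h
    -- Congruence is only the generated equivalence relation, but by the five lemma each generating
    -- morphism is already an isomorphism.
    induction h' with
    | rel X Y h =>
      obtain ⟨e, h₁, h₂⟩ := h
      rw [Category.id_comp] at h₁
      rw [Category.comp_id] at h₂
      let φ : ShortComplex.mk X.i X.p X.zero ⟶ ShortComplex.mk Y.i Y.p Y.zero :=
        { τ₁ := 𝟙 G, τ₂ := e, τ₃ := 𝟙 F, comm₁₂ := by simpa using h₁.symm,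
          comm₂₃ := by simpa using h₂.symm }
      have : IsIso e := ShortComplex.isIso₂_of_shortExact_of_isIso₁₃' φ X.exact Y.exact
        (inferInstanceAs (IsIso (𝟙 G))) (inferInstanceAs (IsIso (𝟙 F)))
      exact ⟨asIso e, h₁, h₂.symm⟩
    | refl X => exact ⟨Iso.refl _, Category.comp_id _, Category.id_comp _⟩
    | symm X Y _ ih =>
      obtain ⟨e, h₁, h₂⟩ := ih
      exact ⟨e.symm, by simp [← h₁], by simp [← h₂]⟩
    | trans X Y Z _ _ ih ih' =>
      obtain ⟨e, h₁, h₂⟩ := ih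
      obtain ⟨e', h₁', h₂'⟩ := ih'
      exact ⟨e ≪≫ e', by simp [reassoc_of% h₁, h₁'], by simp [h₂, h₂']⟩
  · rintro ⟨e, h₁, h₂⟩
    exact Quot.sound ⟨e.hom, by rw [h₁, Category.id_comp], by rw [h₂, Category.comp_id]⟩

variable [U.Faithful] [PreservesFiniteLimits U] (β)

/-- The relative extension group is the cohomology of an injective coresolution. -/
theorem exists_equiv_homCohomology_succ (k : ℕ) :
    ∃ Φ : RelExt U k F G ≃ homCohomology F β.cx (k + 1),
      (∀ (X : MultiExt U k F G) (h : homCohomology F β.cx (k + 1)),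
        Φ (RelExt.mk X) = h ↔ ∃ c : F ⟶ β.cx.X (k + 1),
          IsComparison β.cx k X 0 β.ε (k + 1) c ∧ HasClass c h) ∧
      (∀ x y z : RelExt U k F G, RelExt.IsSum x y z ↔ Φ z = Φ x + Φ y) := by
  choose φ γ hγ hφ using fun X : MultiExt U k F G => exists_isComparison_hasClass β X
  have hφ_iff (X : MultiExt U k F G) (h : homCohomology F β.cx (k + 1)) :
      φ X = h ↔ ∃ c : F ⟶ β.cx.X (k + 1),
        IsComparison β.cx k X 0 β.ε (k + 1) c ∧ HasClass c h := by
    constructor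
    · rintro rfl
      exact ⟨_, hγ X, hφ X⟩
    · rintro ⟨c, hc, hc'⟩
      exact (hγ X).class_unique (hφ X) hc hc'
  have hφ_hom (X Y : MultiExt U k F G) (h : MultiExt.HasHom k X Y (𝟙 G) (𝟙 F)) : φ X = φ Y := by
    have hc := h.isComparison (hγ Y)
    rw [Category.id_comp, Category.id_comp] at hc
    exact (hφ_iff X _).2 ⟨_, hc, hφ Y⟩
  have := β.mono
  let ψ : RelExt U k F G → homCohomology F β.cx (k + 1) := Quot.lift φ hφ_hom
  have hψ : Function.Bijective ψ := by
    constructor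
    · rintro ⟨X⟩ ⟨Y⟩ (hXY : φ X = φ Y)
      -- Any representative of a class is the end of a ladder, so `X` and `Y` both have a ladder
      -- ending in `γ Y`. Finality of `P` gives the zigzag `X ⟶ P ⟵ Y`.
      obtain ⟨P, -, hP⟩ := exists_multiExt_of_cocycle β k (j := k + 1) (by omega) β.ε β.ε_d
        β.exact_zero (γ Y) ((hφ Y).comp_d _)
      have hX := (hγ X).of_hasClass (hφ X) (hXY ▸ hφ Y)
      have h₁ := Quot.sound (r := fun X Y : MultiExt U k F G => MultiExt.HasHom k X Y (𝟙 G) (𝟙 F))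
        (hP X (𝟙 G) (𝟙 F) (by rwa [Category.id_comp, Category.id_comp]))
      have h₂ := Quot.sound (r := fun X Y : MultiExt U k F G => MultiExt.HasHom k X Y (𝟙 G) (𝟙 F))
        (hP Y (𝟙 G) (𝟙 F) (by rw [Category.id_comp, Category.id_comp]; exact hγ Y))
      exact h₁.trans h₂.symm
    · intro h
      obtain ⟨c, hc⟩ := exists_hasClass h
      obtain ⟨P, hP, -⟩ := exists_multiExt_of_cocycle β k (j := k + 1) (by omega) β.ε β.ε_d
        β.exact_zero c (hc.comp_d _)
      exact ⟨RelExt.mk P, (hφ_iff P h).2 ⟨c, hP, hc⟩⟩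
  refine ⟨Equiv.ofBijective ψ hψ, hφ_iff, fun x y z => ⟨?_, ?_⟩⟩
  · rintro ⟨X, Y, Z, rfl, rfl, rfl, b, -, W, hX, hY, hZ⟩
    -- Restricting one ladder on `W` along the three morphisms gives the cocycles `inl ≫ c`, `inr ≫
    -- c` and their sum for `X`, `Y` and `Z`.
    obtain ⟨h, c, hc, -⟩ := exists_isComparison_hasClass β W
    have aux {V : MultiExt U k F G} {g : F ⟶ b.pt} (hV : MultiExt.HasHom k V W (𝟙 G) g) :
        HasClass (g ≫ c) (φ V) := by
      have hV' := hV.isComparison hc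
      rw [Category.id_comp] at hV'
      obtain ⟨h', hh'⟩ := exists_hasClass_of_comp_d _ hV'.comp_d
      rwa [(hφ_iff V h').2 ⟨_, hV', hh'⟩]
    refine (aux hZ).unique ?_
    rw [Preadditive.add_comp]
    exact (aux hX).add (aux hY)
  · obtain ⟨X⟩ := x
    obtain ⟨Y⟩ := y
    obtain ⟨Z⟩ := z
    intro (hZ : φ Z = φ X + φ Y)
    -- The witness `W` is the final sequence for the cocycle `(γ X, γ Y)` on `F ⊕ F`. Its
    -- restriction to the diagonal is `γ X + γ Y`, which represents the class of `Z`, so all three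
    -- morphisms come from finality.
    obtain ⟨P, -, hP⟩ := exists_multiExt_of_cocycle β k (j := k + 1) (by omega) β.ε β.ε_d
      β.exact_zero (biprod.desc (γ X) (γ Y)) (by
        apply biprod.hom_ext'
        · simpa using (hφ X).comp_d _
        · simpa using (hφ Y).comp_d _)
    refine ⟨X, Y, Z, rfl, rfl, rfl, BinaryBiproduct.bicone F F,
      ⟨BinaryBiproduct.isBilimit F F⟩, P, hP _ _ _ ?_, hP _ _ _ ?_, hP _ _ _ ?_⟩
    · rw [Category.id_comp]
      exact (biprod.inl_desc (γ X) (γ Y)).symm ▸ hγ X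
    · rw [Category.id_comp]
      exact (biprod.inr_desc (γ X) (γ Y)).symm ▸ hγ Y
    · rw [Category.id_comp, Preadditive.add_comp]
      have h₁ : (BinaryBiproduct.bicone F F).inl ≫ biprod.desc (γ X) (γ Y) = γ X :=
        biprod.inl_desc _ _
      have h₂ : (BinaryBiproduct.bicone F F).inr ≫ biprod.desc (γ X) (γ Y) = γ Y :=
        biprod.inr_desc _ _
      rw [h₁, h₂]
      exact (hγ Z).of_hasClass (hφ Z) (hZ ▸ (hφ X).add (hφ Y))

end RelExt

/-! ### Coresolutions from a right adjoint -/

section Coresolution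

variable {M : Type u'} [Category.{v'} M]
  {B : Type u''} [Category.{v''} B] {U : M ⥤ B}
  {R : B ⥤ M}

/-- The extension problem transposes to one along `U.map f`, which a retraction solves. -/
lemma isRelInjective_obj_of_adjunction (adj : U ⊣ R) (b : B) : IsRelInjective U (R.obj b) := by
  intro X Y f _ hf g
  refine ⟨adj.homEquiv _ _ (retraction (U.map f) ≫ (adj.homEquiv _ _).symm g), ?_⟩
  rw [← adj.homEquiv_naturality_left, IsSplitMono.id_assoc, Equiv.apply_symm_apply]

variable [Abelian M] [Preadditive B] [U.Additive]

/-- The iterated cokernels of the unit of an adjunction. -/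
noncomputable def cosyzygy (adj : U ⊣ R) (G : M) : ℕ → M
  | 0 => G
  | n + 1 => cokernel (adj.unit.app (cosyzygy adj G n))

variable [U.Faithful]

/-- The coresolution splices the sequences `Z n ⟶ R U (Z n) ⟶ Z (n + 1)`. Under `U` each is split by
the counit `r n` and a section `σ n`, and the contracting homotopy is `r (n + 1) ≫ σ n`. -/
theorem exists_injCoresolution (adj : U ⊣ R) (G : M) :
    ∃ β : InjCoresolution U G, ∀ n, R.essImage (β.cx.X n) := by
  let Z := cosyzygy adj G
  let η (n : ℕ) : Z n ⟶ R.obj (U.obj (Z n)) := adj.unit.app (Z n)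
  let π (n : ℕ) : R.obj (U.obj (Z n)) ⟶ Z (n + 1) := cokernel.π (η n)
  let r (n : ℕ) : U.obj (R.obj (U.obj (Z n))) ⟶ U.obj (Z n) := adj.counit.app (U.obj (Z n))
  have hr (n : ℕ) : U.map (η n) ≫ r n = 𝟙 _ := adj.left_triangle_components (Z n)
  have hηπ (n : ℕ) : η n ≫ π n = 0 := cokernel.condition _
  have hη (n : ℕ) : Mono (η n) := by
    have : IsSplitMono (U.map (η n)) := ⟨⟨⟨r n, hr n⟩⟩⟩
    exact U.mono_of_mono_map inferInstance
  have hπ (n : ℕ) : Epi (π n) := inferInstanceAs (Epi (cokernel.π _))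
  have hUl : U.IsLeftAdjoint := adj.isLeftAdjoint
  have hσ (n : ℕ) : ∃ σ : U.obj (Z (n + 1)) ⟶ U.obj (R.obj (U.obj (Z n))),
      r n ≫ U.map (η n) + U.map (π n) ≫ σ = 𝟙 _ := by
    -- As a left adjoint, `U` preserves this cokernel, so `1 - r U(η)` factors through `U(π)`; the
    -- factor is `σ`.
    have hc := CokernelCofork.mapIsColimit _ (cokernelIsCokernel (η n)) U
    have hw : U.map (η n) ≫ (𝟙 _ - r n ≫ U.map (η n)) = 0 := by
      rw [Preadditive.comp_sub, reassoc_of% (hr n)]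
      simp
    refine ⟨hc.desc (CokernelCofork.ofπ _ hw), ?_⟩
    have := hc.fac (CokernelCofork.ofπ _ hw) WalkingParallelPair.one
    have h' : U.map (π n) ≫ hc.desc (CokernelCofork.ofπ _ hw) = 𝟙 _ - r n ≫ U.map (η n) := this
    rw [h']
    abel
  choose σ hσ using hσ
  have hσπ (n : ℕ) : σ n ≫ U.map (π n) = 𝟙 _ := by
    have : Epi (U.map (π n)) := inferInstance
    rw [← cancel_epi (U.map (π n))]
    have h := congrArg (fun x => x ≫ U.map (π n)) (hσ n)
    simp only [Preadditive.add_comp, Category.assoc, ← U.map_comp (η n), hηπ, U.map_zero,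
      comp_zero, zero_add, Category.id_comp] at h
    rw [h, Category.comp_id]
  let cx : CochainComplex M ℕ := CochainComplex.of (fun n => R.obj (U.obj (Z n)))
    (fun n => π n ≫ η (n + 1)) (fun n => by simp [reassoc_of% (hηπ (n + 1))])
  have hd (n : ℕ) : cx.d n (n + 1) = π n ≫ η (n + 1) :=
    CochainComplex.of_d (fun n => R.obj (U.obj (Z n))) (fun n => π n ≫ η (n + 1)) n
  have hex₀ (n : ℕ) : (ShortComplex.mk (η n) (π n) (hηπ n)).Exact :=
    ShortComplex.exact_of_g_is_cokernel _ (cokernelIsCokernel _)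
  -- The differential is `π` followed by a monomorphism, which does not change its kernel; below,
  -- preceding `η` by the epimorphism `π` does not change the image.
  have hex₁ (n : ℕ) (w) : (ShortComplex.mk (η n) (cx.d n (n + 1)) w).Exact := by
    let φ : ShortComplex.mk (η n) (π n) (hηπ n) ⟶ ShortComplex.mk (η n) (cx.d n (n + 1)) w :=
      { τ₁ := 𝟙 _, τ₂ := 𝟙 _, τ₃ := η (n + 1)
        comm₁₂ := (Category.id_comp _).trans (Category.comp_id _).symm
        comm₂₃ := (Category.id_comp _).trans (hd n) }
    have : Epi φ.τ₁ := inferInstanceAs (Epi (𝟙 _))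
    have : IsIso φ.τ₂ := inferInstanceAs (IsIso (𝟙 _))
    have : Mono φ.τ₃ := hη (n + 1)
    exact (ShortComplex.exact_iff_of_epi_of_isIso_of_mono φ).1 (hex₀ n)
  have hw (n : ℕ) : η n ≫ cx.d n (n + 1) = 0 := by
    rw [hd, reassoc_of% (hηπ n), zero_comp]
  have hex₂ (n : ℕ) (w) :
      (ShortComplex.mk (cx.d n (n + 1)) (cx.d (n + 1) (n + 2)) w).Exact := by
    let φ : ShortComplex.mk (cx.d n (n + 1)) (cx.d (n + 1) (n + 2)) w ⟶
        ShortComplex.mk (η (n + 1)) (cx.d (n + 1) (n + 2)) (hw (n + 1)) :=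
      { τ₁ := π n, τ₂ := 𝟙 _, τ₃ := 𝟙 _
        comm₁₂ := (hd n).symm.trans (Category.comp_id _).symm
        comm₂₃ := (Category.id_comp _).trans (Category.comp_id _).symm }
    have : Epi φ.τ₁ := hπ n
    have : IsIso φ.τ₂ := inferInstanceAs (IsIso (𝟙 _))
    have : Mono φ.τ₃ := inferInstanceAs (Mono (𝟙 _))
    exact (ShortComplex.exact_iff_of_epi_of_isIso_of_mono φ).2 (hex₁ (n + 1) _)
  refine ⟨⟨cx, η 0, hw 0, fun n => isRelInjective_obj_of_adjunction adj _, hη 0, hex₁ 0 _,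
    fun n => hex₂ n _, r 0, fun n => r (n + 1) ≫ σ n, hr 0, ?_, fun n => ?_⟩,
    fun n => R.obj_mem_essImage _⟩
  · rw [hd, U.map_comp, Category.assoc, reassoc_of% (hr 1)]
    exact hσ 0
  · rw [hd, hd, U.map_comp, U.map_comp, Category.assoc, Category.assoc, reassoc_of% (hσπ n),
      reassoc_of% (hr (n + 2))]
    exact hσ (n + 1)

end Coresolution

end RelHom

/-! ### Morphisms out of finite products -/

namespace CategoryTheory.Limits

section FinitePi

variable {A : Type u} [Category.{v} A] [HasZeroMorphisms A] {J : Type*}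

/-- The injection of a summand into a finite product. -/
noncomputable def piInj (f : J → A) [HasBiproduct f] (i : J) : f i ⟶ ∏ᶜ f :=
  biproduct.ι f i ≫ (biproduct.isoProduct f).hom

/-- The morphism out of a finite product with given components. -/
noncomputable def piDesc {f : J → A} [HasBiproduct f] {X : A} (p : ∀ i, f i ⟶ X) : ∏ᶜ f ⟶ X :=
  (biproduct.isoProduct f).inv ≫ biproduct.desc p

lemma piInj_desc {f : J → A} [HasBiproduct f] {X : A} (p : ∀ i, f i ⟶ X) (i : J) :
    piInj f i ≫ piDesc p = p i := by
  rw [piInj, piDesc, Category.assoc, Iso.hom_inv_id_assoc, biproduct.ι_desc]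

lemma piInj_desc_assoc {f : J → A} [HasBiproduct f] {X Y : A} (p : ∀ i, f i ⟶ X) (i : J)
    (h : X ⟶ Y) : piInj f i ≫ piDesc p ≫ h = p i ≫ h := by
  rw [← Category.assoc, piInj_desc]

/-- A finite product is also a coproduct here, so an operation is determined by its unary
components. Both sortwise cokernels and cofree models depend on this. -/
lemma pi_hom_ext_inj {f : J → A} [HasBiproduct f] {X : A} {g h : ∏ᶜ f ⟶ X}
    (H : ∀ i, piInj f i ≫ g = piInj f i ≫ h) : g = h := by
  rw [← cancel_epi (biproduct.isoProduct f).hom]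
  apply biproduct.hom_ext'
  intro i
  simpa only [piInj, Category.assoc] using H i

lemma piInj_map {f g : J → A} [HasBiproduct f] [HasBiproduct g] (p : ∀ i, f i ⟶ g i) (i : J) :
    piInj f i ≫ Pi.map p = p i ≫ piInj g i := by
  have : (biproduct.isoProduct f).hom ≫ Pi.map p =
      biproduct.map p ≫ (biproduct.isoProduct g).hom := by
    apply Pi.hom_ext
    intro j
    simp
  rw [piInj, piInj, Category.assoc, this, biproduct.ι_map_assoc]

lemma piInj_map_assoc {f g : J → A} [HasBiproduct f] [HasBiproduct g] (p : ∀ i, f i ⟶ g i)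
    (i : J) {X : A} (h : ∏ᶜ g ⟶ X) : piInj f i ≫ Pi.map p ≫ h = p i ≫ piInj g i ≫ h := by
  rw [← Category.assoc, piInj_map, Category.assoc]

end FinitePi

end CategoryTheory.Limits

/-! ### The category of models in an abelian category is abelian -/

namespace SortedSignature

variable {S : Type w} {sig : SortedSignature S} {C : Type u} [Category.{v} C] [HasFiniteProducts C]

/-- Families of morphisms that commute with the operations commute with all terms. -/
lemma Term.eval_naturality {X Y : S → C}
    {opX : ∀ o : sig.Op, (∏ᶜ fun i : Fin (sig.arity o).length => X ((sig.arity o).get i)) ⟶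
      X (sig.target o)}
    {opY : ∀ o : sig.Op, (∏ᶜ fun i : Fin (sig.arity o).length => Y ((sig.arity o).get i)) ⟶
      Y (sig.target o)} (h : ∀ s, X s ⟶ Y s)
    (comm : ∀ o, opX o ≫ h (sig.target o) =
      Limits.Pi.map (fun i : Fin (sig.arity o).length => h ((sig.arity o).get i)) ≫ opY o)
    {Γ : List S} {s : S} (t : sig.Term Γ s) :
    t.eval opX ≫ h s = Limits.Pi.map (fun i : Fin Γ.length => h (Γ.get i)) ≫ t.eval opY := by
  induction t with
  | var i => simp only [Term.eval, Pi.map_π]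
  | app o args ih =>
    simp only [Term.eval, Category.assoc, comm]
    simp only [← Category.assoc]
    congr 1
    apply Pi.hom_ext
    intro i
    simp only [Category.assoc, Pi.map_π, Pi.lift_π, Pi.lift_π_assoc, ih]

end SortedSignature

namespace AlgTheory

variable {S : Type w} {T : AlgTheory S} {A : Type u} [Category.{v} A] [Abelian A]

namespace Alg

attribute [local instance] HasFiniteBiproducts.of_hasFiniteProducts

lemma comp_app_eq_zero {X Y Z : T.Alg A} {f : X ⟶ Y} {g : Y ⟶ Z} (h : f ≫ g = 0) (s : S) :
    Hom.app f s ≫ Hom.app g s = 0 :=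
  congrArg (fun k => Hom.app k s) h

/-- A sequence of models which is sortwise a kernel sequence is a kernel sequence. -/
noncomputable def isLimitOfApp {X Y Z : T.Alg A} (i : X ⟶ Y) (f : Y ⟶ Z) (hw : i ≫ f = 0)
    (h : ∀ s, IsLimit (KernelFork.ofι (Hom.app i s) (comp_app_eq_zero hw s))) :
    IsLimit (KernelFork.ofι i hw) :=
  have hm (s : S) : Mono (Hom.app i s) := Fork.IsLimit.mono (h s)
  have : Mono i := ⟨fun a b hab => hom_ext fun s => by
    rw [← cancel_mono (Hom.app i s)]
    exact congrArg (fun k => Hom.app k s) hab⟩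
  KernelFork.IsLimit.ofι' _ _ fun {W} k hk =>
    have hl (s : S) : (h s).lift (KernelFork.ofι (Hom.app k s) (comp_app_eq_zero hk s)) ≫
        Hom.app i s = Hom.app k s := (h s).fac _ WalkingParallelPair.zero
    ⟨{ app := fun s => (h s).lift (KernelFork.ofι (Hom.app k s) (comp_app_eq_zero hk s))
       comm := fun o => by
        rw [← cancel_mono (Hom.app i _), Category.assoc, hl, Category.assoc, Hom.comm i,
          Hom.comm k, ← Category.assoc]
        congr 1
        apply Pi.hom_ext
        intro j
        simp [hl] },
      hom_ext hl⟩

/-- A sequence of models which is sortwise a cokernel sequence is a cokernel sequence. -/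
noncomputable def isColimitOfApp {X Y Z : T.Alg A} (f : X ⟶ Y) (p : Y ⟶ Z) (hw : f ≫ p = 0)
    (h : ∀ s, IsColimit (CokernelCofork.ofπ (Hom.app p s) (comp_app_eq_zero hw s))) :
    IsColimit (CokernelCofork.ofπ p hw) :=
  have he (s : S) : Epi (Hom.app p s) := Cofork.IsColimit.epi (h s)
  have : Epi p := ⟨fun a b hab => hom_ext fun s => by
    rw [← cancel_epi (Hom.app p s)]
    exact congrArg (fun k => Hom.app k s) hab⟩
  CokernelCofork.IsColimit.ofπ' _ _ fun {W} k hk =>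
    have hl (s : S) : Hom.app p s ≫
        (h s).desc (CokernelCofork.ofπ (Hom.app k s) (comp_app_eq_zero hk s)) = Hom.app k s :=
      (h s).fac _ WalkingParallelPair.one
    ⟨{ app := fun s => (h s).desc (CokernelCofork.ofπ (Hom.app k s) (comp_app_eq_zero hk s))
       comm := fun o => by
        -- A finite product of epimorphisms is an epimorphism, being a coproduct as well.
        rw [← cancel_epi (Limits.Pi.map fun i : Fin (T.sig.arity o).length =>
          Hom.app p ((T.sig.arity o).get i)), ← Category.assoc, ← Hom.comm p, Category.assoc, hl,
          Hom.comm k, ← Category.assoc]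
        congr 1
        apply Pi.hom_ext
        intro j
        simp [hl] },
      hom_ext hl⟩

/-! ### Sortwise kernels and cokernels. -/

section Kernel

variable {X Y : T.Alg A} (f : X ⟶ Y)

/-- The sortwise kernel of a morphism of models. -/
noncomputable def kernelObj : T.Alg A where
  carrier s := kernel (Hom.app f s)
  op o := kernel.lift _ (Limits.Pi.map (fun i : Fin (T.sig.arity o).length =>
      kernel.ι (Hom.app f ((T.sig.arity o).get i))) ≫ X.op o) (by
    rw [Category.assoc, Hom.comm f, ← Category.assoc]
    convert zero_comp
    apply Pi.hom_ext
    intro j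
    simp)
  sat e he := by
    rw [← cancel_mono (kernel.ι (Hom.app f e.sort))]
    refine (SortedSignature.Term.eval_naturality (opY := X.op)
      (fun s => kernel.ι (Hom.app f s)) (fun o => kernel.lift_ι _ _ _) e.lhs).trans
      (Eq.trans ?_ (SortedSignature.Term.eval_naturality (opY := X.op)
      (fun s => kernel.ι (Hom.app f s)) (fun o => kernel.lift_ι _ _ _) e.rhs).symm)
    rw [X.sat e he]

/-- The inclusion of the sortwise kernel. -/
noncomputable def kernelHom : kernelObj f ⟶ X :=
  { app := fun s => kernel.ι (Hom.app f s)
    comm := fun _ => kernel.lift_ι _ _ _ : Hom (kernelObj f) X }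

lemma kernelHom_comp : kernelHom f ≫ f = 0 :=
  hom_ext fun s => kernel.condition (Hom.app f s)

/-- The sortwise kernel is a kernel. -/
noncomputable def kernelHomIsLimit : IsLimit (KernelFork.ofι (kernelHom f) (kernelHom_comp f)) :=
  isLimitOfApp _ _ _ fun s => kernelIsKernel (Hom.app f s)

/-- The operations of the sortwise cokernel. -/
noncomputable def cokernelOp (o : T.sig.Op) :
    (∏ᶜ fun i : Fin (T.sig.arity o).length => cokernel (Hom.app f ((T.sig.arity o).get i))) ⟶
      cokernel (Hom.app f (T.sig.target o)) :=
  piDesc fun i => cokernel.desc (Hom.app f ((T.sig.arity o).get i))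
    (piInj (fun i : Fin (T.sig.arity o).length => Y.carrier ((T.sig.arity o).get i)) i ≫ Y.op o ≫
      cokernel.π (Hom.app f (T.sig.target o))) (by
    rw [← piInj_map_assoc (fun i : Fin (T.sig.arity o).length =>
      Hom.app f ((T.sig.arity o).get i)), ← Category.assoc (Limits.Pi.map _), ← Hom.comm f,
      Category.assoc, cokernel.condition, comp_zero, comp_zero])

lemma op_comp_cokernel_π (o : T.sig.Op) : Y.op o ≫ cokernel.π (Hom.app f (T.sig.target o)) =
    Limits.Pi.map (fun i : Fin (T.sig.arity o).length =>
      cokernel.π (Hom.app f ((T.sig.arity o).get i))) ≫ cokernelOp f o := by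
  apply pi_hom_ext_inj
  intro i
  rw [piInj_map_assoc, cokernelOp, piInj_desc, cokernel.π_desc]

/-- The sortwise cokernel of a morphism of models. -/
noncomputable def cokernelObj : T.Alg A where
  carrier s := cokernel (Hom.app f s)
  op o := cokernelOp f o
  sat e he := by
    rw [← cancel_epi (Limits.Pi.map fun i : Fin e.ctx.length =>
      cokernel.π (Hom.app f (e.ctx.get i)))]
    refine (SortedSignature.Term.eval_naturality (opX := Y.op)
      (fun s => cokernel.π (Hom.app f s)) (op_comp_cokernel_π f) e.lhs).symm.trans
      (Eq.trans ?_ (SortedSignature.Term.eval_naturality (opX := Y.op)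
      (fun s => cokernel.π (Hom.app f s)) (op_comp_cokernel_π f) e.rhs))
    rw [Y.sat e he]

/-- The projection to the sortwise cokernel. -/
noncomputable def cokernelHom : Y ⟶ cokernelObj f :=
  { app := fun s => cokernel.π (Hom.app f s)
    comm := op_comp_cokernel_π f : Hom Y (cokernelObj f) }

lemma comp_cokernelHom : f ≫ cokernelHom f = 0 :=
  hom_ext fun s => cokernel.condition (Hom.app f s)

/-- The sortwise cokernel is a cokernel. -/
noncomputable def cokernelHomIsColimit :
    IsColimit (CokernelCofork.ofπ (cokernelHom f) (comp_cokernelHom f)) :=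
  isColimitOfApp _ _ _ fun s => cokernelIsCokernel (Hom.app f s)

instance : HasKernels (T.Alg A) where
  has_limit f := ⟨⟨⟨_, kernelHomIsLimit f⟩⟩⟩

instance : HasCokernels (T.Alg A) where
  has_colimit f := ⟨⟨⟨_, cokernelHomIsColimit f⟩⟩⟩

/-- The kernel of a monomorphism is zero, and its components are the sortwise kernels. -/
lemma mono_app_of_mono [Mono f] (s : S) : Mono (Hom.app f s) := by
  have h : kernelHom f = 0 := zero_of_comp_mono f (kernelHom_comp f)
  exact Preadditive.mono_of_kernel_zero (congrArg (fun k => Hom.app k s) h)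

lemma epi_app_of_epi [Epi f] (s : S) : Epi (Hom.app f s) := by
  have h : cokernelHom f = 0 := zero_of_epi_comp f (comp_cokernelHom f)
  exact Preadditive.epi_of_cokernel_zero (congrArg (fun k => Hom.app k s) h)

end Kernel

/-! ### Sortwise finite products. -/

section Product

variable {J : Type*} [Finite J] (X : J → T.Alg A)

/-- The sortwise product of a finite family of models. -/
noncomputable def piObj : T.Alg A where
  carrier s := ∏ᶜ fun j => (X j).carrier s
  op o := Pi.lift fun j => Limits.Pi.map (fun i : Fin (T.sig.arity o).length =>
    Pi.π (fun j => (X j).carrier ((T.sig.arity o).get i)) j) ≫ (X j).op o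
  sat e he := by
    apply Pi.hom_ext
    intro j
    refine (SortedSignature.Term.eval_naturality (opY := (X j).op)
      (fun s => Pi.π (fun j => (X j).carrier s) j) (fun o => Pi.lift_π _ _) e.lhs).trans
      (Eq.trans ?_ (SortedSignature.Term.eval_naturality (opY := (X j).op)
      (fun s => Pi.π (fun j => (X j).carrier s) j) (fun o => Pi.lift_π _ _) e.rhs).symm)
    rw [(X j).sat e he]

/-- The projections of the sortwise product. -/
noncomputable def piHom (j : J) : piObj X ⟶ X j :=
  { app := fun s => Pi.π (fun j => (X j).carrier s) j
    comm := fun _ => Pi.lift_π _ _ : Hom (piObj X) (X j) }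

/-- The morphism to the sortwise product with given components. -/
noncomputable def piLift {Y : T.Alg A} (f : ∀ j, Y ⟶ X j) : Y ⟶ piObj X :=
  { app := fun s => Pi.lift fun j => Hom.app (f j) s
    comm := fun o => by
      have h : Y.op o ≫ Pi.lift (fun j => Hom.app (f j) (T.sig.target o)) =
          Limits.Pi.map (fun i : Fin (T.sig.arity o).length =>
            Pi.lift fun j => Hom.app (f j) ((T.sig.arity o).get i)) ≫
          Pi.lift fun j => Limits.Pi.map (fun i : Fin (T.sig.arity o).length =>
            Pi.π (fun j => (X j).carrier ((T.sig.arity o).get i)) j) ≫ (X j).op o := by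
        apply Pi.hom_ext
        intro j
        rw [Category.assoc, Pi.lift_π, Hom.comm (f j), Category.assoc, Pi.lift_π, ← Category.assoc]
        congr 1
        apply Pi.hom_ext
        intro i
        simp only [Category.assoc, Pi.map_π, Pi.lift_π, Pi.map_π_assoc]
      exact h : Hom Y (piObj X) }

lemma hasProduct : HasProduct X :=
  ⟨⟨⟨Fan.mk (piObj X) (piHom X), Fan.IsLimit.mk _ (fun s => piLift X s.proj)
    (fun s j => hom_ext fun _ => Pi.lift_π _ _) (fun s m hm => hom_ext fun t => by
      apply Pi.hom_ext
      intro j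
      exact (congrArg (fun k => Hom.app k t) (hm j)).trans
        (Pi.lift_π (fun j => Hom.app (s.proj j) t) j).symm)⟩⟩⟩

instance : HasFiniteProducts (T.Alg A) where
  out _ := { has_limit := fun F =>
    have : HasLimit (Discrete.functor (F.obj ∘ Discrete.mk)) := hasProduct fun j => F.obj ⟨j⟩
    hasLimit_of_iso (Discrete.natIsoFunctor (F := F)).symm }

end Product

/-- Models of an algebraic theory in an abelian category form an abelian category. -/
noncomputable instance : Abelian (T.Alg A) where
  normalMonoOfMono f _ :=
    have (s : S) : Mono (Hom.app f s) := mono_app_of_mono f s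
    ⟨⟨_, cokernelHom f, comp_cokernelHom f, isLimitOfApp _ _ _ fun s =>
      Abelian.monoIsKernelOfCokernel (CokernelCofork.ofπ _ (cokernel.condition _)) (cokernelIsCokernel (Hom.app f s))⟩⟩
  normalEpiOfEpi f _ :=
    have (s : S) : Epi (Hom.app f s) := epi_app_of_epi f s
    ⟨⟨_, kernelHom f, kernelHom_comp f, isColimitOfApp _ _ _ fun s =>
      Abelian.epiIsCokernelOfKernel (KernelFork.ofι _ (kernel.condition _)) (kernelIsKernel (Hom.app f s))⟩⟩

end Alg

/-! ### Exactness of the forgetful functor -/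

instance : (T.forget A).Faithful where
  map_injective h := Alg.hom_ext (congrFun h)

open scoped ZeroObject in
instance : HasZeroObject (S → A) :=
  ⟨⟨fun _ => (0 : A), fun _ => ⟨⟨⟨fun _ => 0⟩, fun _ => funext fun _ => (isZero_zero A).eq_of_src _ _⟩⟩,
    fun _ => ⟨⟨⟨fun _ => 0⟩, fun _ => funext fun _ => (isZero_zero A).eq_of_tgt _ _⟩⟩⟩⟩

/-- For an additive functor, left exactness reduces to the preservation of kernels. -/
instance {X Y : T.Alg A} (f : X ⟶ Y) : PreservesLimit (parallelPair f 0) (T.forget A) := by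
  refine preservesLimit_of_preserves_limit_cone (Alg.kernelHomIsLimit f)
    ((KernelFork.isLimitMapConeEquiv _ _).symm ?_)
  have : Mono ((T.forget A).map (Alg.kernelHom f)) := ⟨fun a b hab => funext fun s =>
    (cancel_mono (kernel.ι (Alg.Hom.app f s))).1 (congrFun hab s)⟩
  exact KernelFork.IsLimit.ofι' ((T.forget A).map (Alg.kernelHom f))
    (by rw [← Functor.map_comp, Alg.kernelHom_comp, Functor.map_zero]) fun {W} k hk =>
    ⟨fun s => kernel.lift (Alg.Hom.app f s) (k s) (congrFun hk s),
      funext fun s => kernel.lift_ι _ _ _⟩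

instance : PreservesFiniteLimits (T.forget A) :=
  have : HasBinaryBiproducts (T.Alg A) := Abelian.hasBinaryBiproducts
  (T.forget A).preservesFiniteLimits_of_preservesKernels

end AlgTheory

/-! ### Cofree models -/

namespace AlgTheory

variable {S : Type w} (T : AlgTheory S)

/-- Composable strings of inputs of operation symbols. -/
inductive Path : S → S → Type w
  | nil (s : S) : Path s s
  | cons (o : T.sig.Op) (i : Fin (T.sig.arity o).length) {t : S} (q : Path (T.sig.target o) t) :
      Path ((T.sig.arity o).get i) t

variable {T} {A : Type u} [Category.{v} A]

section PathProd

variable [HasLimitsOfSize.{w, w} A] (X : S → A)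

/-- The product of the objects of a family over all paths from a given sort. -/
noncomputable def pathProd (T : AlgTheory S) (X : S → A) (s : S) : A :=
  ∏ᶜ fun p : Σ t, T.Path s t => X p.1

/-- The projection of `pathProd` belonging to a path. -/
noncomputable def pathProj {s t : S} (p : T.Path s t) : pathProd T X s ⟶ X t :=
  Pi.π (fun p : Σ t, T.Path s t => X p.1) ⟨t, p⟩

variable {X} in
/-- The morphism to `pathProd` with given components. -/
noncomputable def pathLift {Y : A} {s : S} (f : ∀ t, T.Path s t → (Y ⟶ X t)) :
    Y ⟶ pathProd T X s :=
  Pi.lift fun p => f p.1 p.2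

variable {X} in
lemma pathLift_proj {Y : A} {s t : S} (f : ∀ t, T.Path s t → (Y ⟶ X t)) (p : T.Path s t) :
    pathLift f ≫ pathProj X p = f t p :=
  Pi.lift_π _ _

variable {X} in
lemma path_hom_ext {Y : A} {s : S} {f g : Y ⟶ pathProd T X s}
    (h : ∀ t (p : T.Path s t), f ≫ pathProj X p = g ≫ pathProj X p) : f = g :=
  Pi.hom_ext _ _ fun p => h p.1 p.2

end PathProd

variable [Abelian A]

attribute [local instance] HasFiniteBiproducts.of_hasFiniteProducts

/-- The action of a path for a family of objects with operations. -/
noncomputable def Path.act {V : S → A}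
    (op : ∀ o : T.sig.Op, (∏ᶜ fun i : Fin (T.sig.arity o).length => V ((T.sig.arity o).get i)) ⟶
      V (T.sig.target o)) : ∀ {s t : S}, T.Path s t → (V s ⟶ V t)
  | _, _, .nil _ => 𝟙 _
  | _, _, .cons o i q =>
      piInj (fun i : Fin (T.sig.arity o).length => V ((T.sig.arity o).get i)) i ≫ op o ≫ q.act op

lemma Path.act_naturality {V W : S → A}
    {opV : ∀ o : T.sig.Op, (∏ᶜ fun i : Fin (T.sig.arity o).length => V ((T.sig.arity o).get i)) ⟶
      V (T.sig.target o)}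
    {opW : ∀ o : T.sig.Op, (∏ᶜ fun i : Fin (T.sig.arity o).length => W ((T.sig.arity o).get i)) ⟶
      W (T.sig.target o)} (h : ∀ s, V s ⟶ W s)
    (comm : ∀ o, opV o ≫ h (T.sig.target o) =
      Limits.Pi.map (fun i : Fin (T.sig.arity o).length => h ((T.sig.arity o).get i)) ≫ opW o)
    {s t : S} (p : T.Path s t) : p.act opV ≫ h t = h s ≫ p.act opW := by
  induction p with
  | nil s => simp only [Path.act, Category.id_comp, Category.comp_id]
  | cons o i q ih =>
    simp only [Path.act, Category.assoc]
    rw [ih, reassoc_of% (comm o), piInj_map_assoc]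

variable [HasLimitsOfSize.{w, w} A] (X : S → A)

/-- The operations on path products: precomposition of paths. -/
noncomputable def pathOp (o : T.sig.Op) :
    (∏ᶜ fun i : Fin (T.sig.arity o).length => pathProd T X ((T.sig.arity o).get i)) ⟶
      pathProd T X (T.sig.target o) :=
  piDesc fun i => pathLift fun _ q => pathProj X (.cons o i q)

lemma piInj_pathOp_proj (o : T.sig.Op) (i : Fin (T.sig.arity o).length) {t : S}
    (q : T.Path (T.sig.target o) t) :
    piInj (fun i : Fin (T.sig.arity o).length => pathProd T X ((T.sig.arity o).get i)) i ≫
      pathOp X o ≫ pathProj X q = pathProj X (.cons o i q) := by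
  rw [pathOp, piInj_desc_assoc, pathLift_proj]

/-- Acting by `p` shifts the path index by `p`, so the component at `p` can be read off at the empty
path. Hence a homomorphism to a cofree model is determined by its components at empty paths. -/
lemma act_pathOp_proj_nil {s t : S} (p : T.Path s t) :
    p.act (pathOp X) ≫ pathProj X (.nil t) = pathProj X p := by
  induction p with
  | nil s => simp only [Path.act, Category.id_comp]
  | cons o i q ih =>
    simp only [Path.act, Category.assoc]
    rw [ih, piInj_pathOp_proj]

/-- The defects of the equations of the theory on path products. -/
noncomputable def pathDefect (T : AlgTheory S) (X : S → A) (s : S) : pathProd T X s ⟶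
    ∏ᶜ fun r : Σ (e : T.eqns) (i : Fin e.1.ctx.length), T.Path s (e.1.ctx.get i) =>
      pathProd T X r.1.1.sort :=
  -- The defect of each equation is taken on each variable separately and after every path leading
  -- to its sort; quantifying over all paths makes the kernel stable under the operations.
  Pi.lift fun r => r.2.2.act (pathOp X) ≫
    piInj (fun i : Fin r.1.1.ctx.length => pathProd T X (r.1.1.ctx.get i)) r.2.1 ≫
      (r.1.1.lhs.eval (pathOp X) - r.1.1.rhs.eval (pathOp X))

variable {X} in
lemma comp_pathDefect_eq_zero_iff {Y : A} {s : S} (f : Y ⟶ pathProd T X s) :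
    f ≫ pathDefect T X s = 0 ↔
      ∀ e ∈ T.eqns, ∀ (i : Fin e.ctx.length) (p : T.Path s (e.ctx.get i)),
        f ≫ p.act (pathOp X) ≫ piInj (fun i : Fin e.ctx.length => pathProd T X (e.ctx.get i)) i ≫
          e.lhs.eval (pathOp X) =
        f ≫ p.act (pathOp X) ≫ piInj (fun i : Fin e.ctx.length => pathProd T X (e.ctx.get i)) i ≫
          e.rhs.eval (pathOp X) := by
  constructor
  · intro h e he i p
    have := congrArg (fun g => g ≫ Pi.π (fun r : Σ (e : T.eqns) (i : Fin e.1.ctx.length),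
      T.Path s (e.1.ctx.get i) => pathProd T X r.1.1.sort) ⟨⟨e, he⟩, i, p⟩) h
    simpa only [pathDefect, Category.assoc, Pi.lift_π, zero_comp, Preadditive.comp_sub,
      sub_eq_zero] using this
  · intro h
    apply Pi.hom_ext
    rintro ⟨⟨e, he⟩, i, p⟩
    simpa only [pathDefect, Category.assoc, Pi.lift_π, zero_comp, Preadditive.comp_sub,
      sub_eq_zero] using h e he i p

/-- The operations of the cofree model. -/
noncomputable def cofreeOp (o : T.sig.Op) :
    (∏ᶜ fun i : Fin (T.sig.arity o).length => kernel (pathDefect T X ((T.sig.arity o).get i))) ⟶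
      kernel (pathDefect T X (T.sig.target o)) :=
  kernel.lift _ (Limits.Pi.map (fun i : Fin (T.sig.arity o).length =>
      kernel.ι (pathDefect T X ((T.sig.arity o).get i))) ≫ pathOp X o) (by
    rw [comp_pathDefect_eq_zero_iff]
    intro e he i p
    apply pi_hom_ext_inj
    intro j
    -- On the `j`-th summand, the condition for `p` after applying `o` is the condition for the
    -- longer path `.cons o j p`.
    have := (comp_pathDefect_eq_zero_iff (kernel.ι (pathDefect T X ((T.sig.arity o).get j)))).1
      (kernel.condition _) e he i (.cons o j p)
    simp only [Path.act, Category.assoc] at this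
    simpa only [Category.assoc, piInj_map_assoc] using this)

lemma cofreeOp_ι (o : T.sig.Op) : cofreeOp X o ≫ kernel.ι (pathDefect T X (T.sig.target o)) =
    Limits.Pi.map (fun i : Fin (T.sig.arity o).length =>
      kernel.ι (pathDefect T X ((T.sig.arity o).get i))) ≫ pathOp X o :=
  kernel.lift_ι _ _ _

/-- The cofree model on a family of objects: the largest part of the path products on which the
equations hold. -/
noncomputable def cofree (T : AlgTheory S) (X : S → A) : T.Alg A where
  carrier s := kernel (pathDefect T X s)
  op o := cofreeOp X o
  sat e he := by
    rw [← cancel_mono (kernel.ι (pathDefect T X e.sort))]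
    refine (SortedSignature.Term.eval_naturality (fun s => kernel.ι (pathDefect T X s))
      (cofreeOp_ι X) e.lhs).trans (Eq.trans ?_ (SortedSignature.Term.eval_naturality
        (fun s => kernel.ι (pathDefect T X s)) (cofreeOp_ι X) e.rhs).symm)
    apply pi_hom_ext_inj
    intro i
    -- The condition for the empty path is the equation itself, restricted to the `i`-th variable.
    have := (comp_pathDefect_eq_zero_iff (kernel.ι (pathDefect T X (e.ctx.get i)))).1
      (kernel.condition _) e he i (.nil _)
    simpa only [Path.act, Category.id_comp, piInj_map_assoc] using this

/-! ### The universal property of cofree models. -/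

section HomEquiv

variable {X} {Y : T.Alg A}

/-- The morphism to the path product given by the action of paths. -/
noncomputable def toPathProd (f : ∀ s, Y.carrier s ⟶ X s) (s : S) :
    Y.carrier s ⟶ pathProd T X s :=
  pathLift fun t p => p.act Y.op ≫ f t

lemma op_comp_toPathProd (f : ∀ s, Y.carrier s ⟶ X s) (o : T.sig.Op) :
    Y.op o ≫ toPathProd f (T.sig.target o) =
      Limits.Pi.map (fun i : Fin (T.sig.arity o).length => toPathProd f ((T.sig.arity o).get i)) ≫
        pathOp X o := by
  apply pi_hom_ext_inj
  intro i
  apply path_hom_ext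
  intro t q
  rw [piInj_map_assoc, Category.assoc, Category.assoc, Category.assoc, Category.assoc,
    piInj_pathOp_proj, toPathProd, toPathProd, pathLift_proj, pathLift_proj]
  simp only [Path.act, Category.assoc]

/-- `toPathProd f` commutes with operations, hence with paths and terms, so each defect on it comes
from a defect in `Y`, where the equations hold. -/
lemma toPathProd_comp_pathDefect (f : ∀ s, Y.carrier s ⟶ X s) (s : S) :
    toPathProd f s ≫ pathDefect T X s = 0 := by
  rw [comp_pathDefect_eq_zero_iff]
  intro e he i p
  have h (t : T.sig.Term e.ctx e.sort) :
      toPathProd f s ≫ p.act (pathOp X) ≫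
        piInj (fun i : Fin e.ctx.length => pathProd T X (e.ctx.get i)) i ≫ t.eval (pathOp X) =
      p.act Y.op ≫ piInj (fun i : Fin e.ctx.length => Y.carrier (e.ctx.get i)) i ≫
        t.eval Y.op ≫ toPathProd f e.sort := by
    rw [SortedSignature.Term.eval_naturality _ (op_comp_toPathProd f), piInj_map_assoc,
      ← Category.assoc, ← Path.act_naturality _ (op_comp_toPathProd f), Category.assoc]
  rw [h, h, Y.sat e he]

/-- The morphism to the cofree model induced by a family of morphisms. -/
noncomputable def toCofree (f : ∀ s, Y.carrier s ⟶ X s) : Y ⟶ cofree T X :=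
  { app := fun s => kernel.lift _ (toPathProd f s) (toPathProd_comp_pathDefect f s)
    comm := fun o => by
      have h : Y.op o ≫ kernel.lift _ (toPathProd f (T.sig.target o))
            (toPathProd_comp_pathDefect f (T.sig.target o)) =
          Limits.Pi.map (fun i : Fin (T.sig.arity o).length =>
            kernel.lift _ (toPathProd f ((T.sig.arity o).get i))
              (toPathProd_comp_pathDefect f ((T.sig.arity o).get i))) ≫ cofreeOp X o := by
        rw [← cancel_mono (kernel.ι (pathDefect T X (T.sig.target o))), Category.assoc,
          kernel.lift_ι, Category.assoc, cofreeOp_ι, op_comp_toPathProd, ← Category.assoc]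
        congr 1
        apply Pi.hom_ext
        intro i
        simp only [Category.assoc, Pi.map_π, Pi.map_π_assoc, kernel.lift_ι]
      exact h : Alg.Hom Y (cofree T X) }

/-- The universal morphisms from the cofree model to the given family. -/
noncomputable def fromCofree (T : AlgTheory S) (X : S → A) (s : S) :
    (cofree T X).carrier s ⟶ X s :=
  kernel.ι (pathDefect T X s) ≫ pathProj X (.nil s)

lemma toCofree_comp_fromCofree (f : ∀ s, Y.carrier s ⟶ X s) (s : S) :
    Alg.Hom.app (toCofree f) s ≫ fromCofree T X s = f s := by
  refine (kernel.lift_ι_assoc _ _ _ _).trans ?_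
  rw [toPathProd, pathLift_proj, Path.act, Category.id_comp]

/-- The component of `g` at `p` is its component at the empty path after acting by `p`, and `g` and
the inclusion into the path products commute with that action. -/
lemma toCofree_of_hom (g : Y ⟶ cofree T X) :
    toCofree (fun s => Alg.Hom.app g s ≫ fromCofree T X s) = g := by
  refine Alg.hom_ext fun s => (cancel_mono (kernel.ι (pathDefect T X s))).1 ?_
  refine (kernel.lift_ι _ _ _).trans (path_hom_ext fun t p => ?_)
  rw [toPathProd, pathLift_proj, fromCofree]
  have key (gs : Y.carrier s ⟶ kernel (pathDefect T X s))
      (gt : Y.carrier t ⟶ kernel (pathDefect T X t))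
      (c : kernel (pathDefect T X s) ⟶ kernel (pathDefect T X t))
      (h₁ : p.act Y.op ≫ gt = gs ≫ c)
      (h₂ : c ≫ kernel.ι (pathDefect T X t) = kernel.ι (pathDefect T X s) ≫ p.act (pathOp X)) :
      p.act Y.op ≫ gt ≫ kernel.ι (pathDefect T X t) ≫ pathProj X (.nil t) =
        (gs ≫ kernel.ι (pathDefect T X s)) ≫ pathProj X p := by
    rw [reassoc_of% h₁, reassoc_of% h₂, act_pathOp_proj_nil, Category.assoc]
  exact key _ _ _ (Path.act_naturality _ (Alg.Hom.comm g) p)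
    (Path.act_naturality (fun s => kernel.ι (pathDefect T X s)) (cofreeOp_ι X) p)

end HomEquiv

/-- The forgetful functor has a right adjoint. -/
theorem forget_isLeftAdjoint (T : AlgTheory S) (A : Type u) [Category.{v} A] [Abelian A]
    [HasLimitsOfSize.{w, w} A] : (T.forget A).IsLeftAdjoint :=
  (Adjunction.adjunctionOfEquivRight (F := T.forget A) (G_obj := cofree T)
    (fun Y X =>
      { toFun := fun f => toCofree f
        invFun := fun g s => Alg.Hom.app g s ≫ fromCofree T X s
        left_inv := fun f => funext fun s => toCofree_comp_fromCofree f s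
        right_inv := toCofree_of_hom })
    (fun Y' Y X f g => by
      -- Naturality holds because both sides have the same composite with `fromCofree`, which
      -- determines a homomorphism to a cofree model.
      refine Eq.trans ?_ (toCofree_of_hom (f ≫ toCofree g))
      refine congrArg toCofree (funext fun s => ?_)
      exact ((Category.assoc _ _ _).trans
        (congrArg _ (toCofree_comp_fromCofree g s))).symm)).isLeftAdjoint

end AlgTheory

theorem mainTheorem1 {S : Type w} (T : AlgTheory S) (A : Type u) [Category.{v} A] [Abelian A]
    [HasLimitsOfSize.{w, w} A] (F G : T.Alg A) :
    -- the forgetful functor has a right adjoint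
    (T.forget A).IsLeftAdjoint ∧
    -- each right adjoint yields a coresolution of `G` by objects in its image
    (∀ (R : (S → A) ⥤ T.Alg A) (_ : T.forget A ⊣ R),
      ∃ β : RelHom.InjCoresolution (T.forget A) G, ∀ n, R.essImage (β.cx.X n)) ∧
    -- for each coresolution `β`, the group `Hⁿ(Hom(F, β))` is the relative Ext group: `n = 0`
    (∀ β : RelHom.InjCoresolution (T.forget A) G,
      (∃ Φ : (F ⟶ G) ≃+ RelHom.homCohomology F β.cx 0,
        ∀ f : F ⟶ G, RelHom.HasClass (f ≫ β.ε) (Φ f)) ∧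
    -- `n = k + 1`
      ∀ k : ℕ, ∃ Φ : RelHom.RelExt (T.forget A) k F G ≃ RelHom.homCohomology F β.cx (k + 1),
        (∀ (X : RelHom.MultiExt (T.forget A) k F G) (h : RelHom.homCohomology F β.cx (k + 1)),
          Φ (RelHom.RelExt.mk X) = h ↔
            ∃ c : F ⟶ β.cx.X (k + 1),
              RelHom.IsComparison β.cx k X 0 β.ε (k + 1) c ∧ RelHom.HasClass c h) ∧
        (∀ x y z : RelHom.RelExt (T.forget A) k F G,
          RelHom.RelExt.IsSum x y z ↔ Φ z = Φ x + Φ y)) ∧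
    -- for `n = 1` the relative Ext group consists of the equivalence classes of split extensions
    (∀ X Y : RelHom.ShortExt (T.forget A) F G,
      RelHom.RelExt.mk (k := 0) X = RelHom.RelExt.mk (k := 0) Y ↔
        X.Equivalent Y) :=
  ⟨T.forget_isLeftAdjoint A, fun _ adj => RelHom.exists_injCoresolution adj G,
    fun β => ⟨RelHom.exists_addEquiv_homCohomology_zero β,
      RelHom.exists_equiv_homCohomology_succ β⟩,
    RelHom.mk_eq_mk_iff_equivalent⟩
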